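/- Let $N\ge 1$ be an integer and $\tfrac12<s<1$ with $N>2s$, let $\lambda>0$ and $R_0>0$, and let $f\colon(0,\infty)\to(0,\infty)$ be continuous with $\liminf_{t\to0^+} f(t)/t^p>0$. Suppose that either $$1<q<\frac{N}{N+1-2s}\quad\text{and}\quad 0<p<\frac{(2s-1)q}{2s-q},$$ or $$q\ge\frac{N}{N+1-2s}\quad\text{and}\quad 0<p<\frac{N}{N-2s}.$$ Let $(-\Delta)^s u(x)=C\lim_{\varepsilon\to0^+}\int_{\{|x-y|\ge\varepsilon\}}\frac{u(x)-u(y)}{|x-y|^{N+2s}}\,dy$, where $C>0$ is any fixed normalization constant. Let $B_{R_0}$ be the closed ball of radius $R_0$ centred at the origin. Then there is no function $u\colon\mathbb{R}^N\to(0,\infty)$ such that (i) $u\in C^2(\mathbb{R}^N\setminus B_{R_0})$ and $\int_{\mathbb{R}^N}\frac{|u(x)|}{1+|x|^{N+2s}}\,dx<\infty$; (ii) $(-\Delta)^s u(x)+|\nabla u(x)|^q\ge\lambda f(u(x))$ for every $x\in\mathbb{R}^N\setminus B_{R_0}$; (iii) $u$ does not blow up at infinity, that is, it is not the case that $u(x)\to+\infty$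 as $|x|\to\infty$. In other words, the equation $(-\Delta)^s u+|\nabla u|^q=\lambda f(u)$ in $\mathbb{R}^N\setminus B_{R_0}$ has no positive classical supersolution that does not blow up at infinity. -/

import Mathlib

open Filter Topology MeasureTheory

/-- The weighted space of all `u : ℝ^N → ℝ` with `∫ |u(x)| / (1 + |x|^(N+2s)) dx < ∞`. -/
def MemL2s (N : ℕ) (s : ℝ) (u : EuclideanSpace ℝ (Fin N) → ℝ) : Prop :=
  Integrable (fun x => u x / (1 + ‖x‖ ^ ((N : ℝ) + 2 * s)))

/-- The fractional Laplacian of order `s` of `u`, with normalization constant `C`, exists at the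
point `x` in the principal value sense and is equal to `L`. -/
def HasFracLaplacianAt (N : ℕ) (s C : ℝ) (u : EuclideanSpace ℝ (Fin N) → ℝ)
    (x : EuclideanSpace ℝ (Fin N)) (L : ℝ) : Prop :=
  Tendsto
    (fun ε : ℝ => C * ∫ y in (Metric.ball x ε)ᶜ, (u x - u y) / ‖x - y‖ ^ ((N : ℝ) + 2 * s))
    (𝓝[>] 0) (𝓝 L)

/-- `u` is a classical supersolution of `(-Δ)^s u + |∇u|^q = lam * f(u)` outside the ball of
radius `R₀` centred at the origin, `C` being the normalization constant of `(-Δ)^s`. -/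
structure IsClassicalSupersolution (N : ℕ) (s C q lam R₀ : ℝ) (f : ℝ → ℝ)
    (u : EuclideanSpace ℝ (Fin N) → ℝ) : Prop where
  contDiffOn : ContDiffOn ℝ 2 u (Metric.closedBall 0 R₀)ᶜ
  memL2s : MemL2s N s u
  le : ∀ x ∈ (Metric.closedBall (0 : EuclideanSpace ℝ (Fin N)) R₀)ᶜ,
    ∃ L : ℝ, HasFracLaplacianAt N s C u x L ∧ lam * f (u x) ≤ L + ‖gradient u x‖ ^ q

/-- `u(x) → +∞` as `|x| → ∞`. -/
def BlowsUpAtInfinity {N : ℕ} (u : EuclideanSpace ℝ (Fin N) → ℝ) : Prop :=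
  Tendsto u (cocompact (EuclideanSpace ℝ (Fin N))) atTop

/-! A positive supersolution cannot decay too fast, because of the diffusion and the gradient term,
while the reaction `f(u)` forces it to decay faster and faster along a sequence. The two bounds
collide. The hypotheses on p and q supply an exponent θ > N - 2s with θ + 2s ≤ q(θ + 1) and pθ < θ +
2s (`exists_decay_exponent`).

Lower bound (`IsClassicalSupersolution.lower_bound`): u ≥ κ|x|^(-θ) far out. The power |x|^(-(N-2s))
is the fundamental solution, so a larger power of it, being a convex function of it, is a strict
subsolution: cut off near 0, |x|^(-θ) has fractional Laplacian at most -c|x|^(-θ-2s). At a point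
where u touches a small multiple κ of this barrier from above (up to a constant), |∇u|^q is of order
κ^q |x|^(-q(θ+1)) and is absorbed, so the left side of the inequality would be at most 0 < λf(u).

Upper bound (`IsClassicalSupersolution.frequentlyDecays_improve`): if u(x₀) is at most of order A =
|x₀|^(-α), a paraboloid of height A and width |x₀|/2 touches u from below at some x nearby, where
λf(u(x)) is at most a constant times A|x₀|^(-2s) + (A/|x₀|)^q. As f(t) ≥ ct^p for bounded t, u(x) is
at most of order |x|^(-α') whenever pα' ≤ min(α + 2s, q(α + 1)). Not blowing up gives α = 0 to
start, and while α ≤ θ each step gains a fixed δ (`exists_exponent_increment`). So α eventually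
exceeds θ, against the lower bound. -/

/-! ### Radial integrals, translations and symmetry. -/

/-- The surface area of the unit sphere of `ℝ^N`. -/
noncomputable def unitSphereArea (N : ℕ) : ℝ :=
  N * volume.real (Metric.ball (0 : EuclideanSpace ℝ (Fin N)) 1)

theorem unitSphereArea_pos {N : ℕ} (hN : 0 < N) : 0 < unitSphereArea N := by
  unfold unitSphereArea
  have h : 0 < volume.real (Metric.ball (0 : EuclideanSpace ℝ (Fin N)) 1) :=
    ENNReal.toReal_pos (Metric.measure_ball_pos _ _ one_pos).ne' measure_ball_lt_top.ne
  have : (0 : ℝ) < N := by exact_mod_cast hN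
  positivity

theorem nontrivial_euclideanSpace {N : ℕ} (hN : 0 < N) :
    Nontrivial (EuclideanSpace ℝ (Fin N)) := by
  have : Nonempty (Fin N) := ⟨⟨0, hN⟩⟩
  infer_instance

theorem pow_pred_mul_rpow {N : ℕ} (hN : 0 < N) (e : ℝ) {y : ℝ} (hy : 0 < y) :
    y ^ (N - 1) * y ^ e = y ^ ((N : ℝ) - 1 + e) := by
  rw [Real.rpow_add hy, ← Real.rpow_natCast, Nat.cast_sub hN, Nat.cast_one]

theorem indicator_compl_ball_norm {N : ℕ} (ρ : ℝ) (g : ℝ → ℝ) :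
    (Metric.ball (0 : EuclideanSpace ℝ (Fin N)) ρ)ᶜ.indicator (fun z => g ‖z‖) =
      fun z => (Set.Ici ρ).indicator g ‖z‖ := by
  ext z
  simp [Set.indicator]

theorem indicator_ball_norm {N : ℕ} (ρ : ℝ) (g : ℝ → ℝ) :
    (Metric.ball (0 : EuclideanSpace ℝ (Fin N)) ρ).indicator (fun z => g ‖z‖) =
      fun z => (Set.Iio ρ).indicator g ‖z‖ := by
  ext z
  simp [Set.indicator]

theorem integrableOn_compl_ball_norm_rpow {N : ℕ} (hN : 0 < N) {e ρ : ℝ} (he : e < -N)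
    (hρ : 0 < ρ) :
    IntegrableOn (fun z : EuclideanSpace ℝ (Fin N) => ‖z‖ ^ e) (Metric.ball 0 ρ)ᶜ := by
  have := nontrivial_euclideanSpace hN
  rw [← integrable_indicator_iff Metric.isOpen_ball.measurableSet.compl,
    indicator_compl_ball_norm ρ (fun r => r ^ e),
    integrable_fun_norm_addHaar volume (f := (Set.Ici ρ).indicator (fun r : ℝ => r ^ e))]
  have h1 : IntegrableOn (fun y : ℝ => y ^ ((N : ℝ) - 1 + e)) (Set.Ici ρ) := by
    rw [integrableOn_Ici_iff_integrableOn_Ioi]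
    exact integrableOn_Ioi_rpow_of_lt (by linarith) hρ
  have h2 := (integrable_indicator_iff measurableSet_Ici).2 h1
  refine (h2.integrableOn (s := Set.Ioi 0)).congr_fun (fun y hy => ?_) measurableSet_Ioi
  rw [finrank_euclideanSpace_fin]
  by_cases h : ρ ≤ y
  · simp [h, pow_pred_mul_rpow hN e hy]
  · simp [h]

theorem setIntegral_compl_ball_norm_rpow {N : ℕ} (hN : 0 < N) {e ρ : ℝ} (he : e < -N)
    (hρ : 0 < ρ) :
    ∫ z in (Metric.ball (0 : EuclideanSpace ℝ (Fin N)) ρ)ᶜ, ‖z‖ ^ e =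
      unitSphereArea N * (ρ ^ (N + e) / -(N + e)) := by
  have := nontrivial_euclideanSpace hN
  rw [← integral_indicator Metric.isOpen_ball.measurableSet.compl,
    indicator_compl_ball_norm ρ (fun r => r ^ e),
    integral_fun_norm_addHaar volume ((Set.Ici ρ).indicator (fun r : ℝ => r ^ e))]
  rw [finrank_euclideanSpace_fin, unitSphereArea, nsmul_eq_mul, smul_eq_mul, mul_assoc]
  congr 2
  calc ∫ y in Set.Ioi (0 : ℝ), y ^ (N - 1) • (Set.Ici ρ).indicator (fun r : ℝ => r ^ e) y
      = ∫ y in Set.Ioi (0 : ℝ), (Set.Ici ρ).indicator (fun r : ℝ => r ^ ((N : ℝ) - 1 + e)) y := by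
        refine setIntegral_congr_fun measurableSet_Ioi (fun y hy => ?_)
        by_cases h : ρ ≤ y
        · simp [h, pow_pred_mul_rpow hN e hy]
        · simp [h]
    _ = ∫ y in Set.Ioi ρ, y ^ ((N : ℝ) - 1 + e) := by
        rw [setIntegral_indicator measurableSet_Ici, Set.inter_eq_right.2, integral_Ici_eq_integral_Ioi]
        exact fun y hy => hρ.trans_le hy
    _ = ρ ^ (N + e) / -(N + e) := by
        rw [integral_Ioi_rpow_of_lt (by linarith) hρ, div_neg, neg_div]
        ring_nf

theorem integrableOn_ball_norm_rpow {N : ℕ} (hN : 0 < N) {e : ℝ} (he : -(N : ℝ) < e) (ρ : ℝ) :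
    IntegrableOn (fun z : EuclideanSpace ℝ (Fin N) => ‖z‖ ^ e) (Metric.ball 0 ρ) := by
  have := nontrivial_euclideanSpace hN
  rw [integrableOn_fun_norm_addHaar volume (f := fun r : ℝ => r ^ e)]
  have h1 : IntegrableOn (fun y : ℝ => y ^ ((N : ℝ) - 1 + e)) (Set.Ioo 0 ρ) := by
    rcases le_or_gt ρ 0 with h | h
    · simp [Set.Ioo_eq_empty_of_le h]
    · rw [intervalIntegral.integrableOn_Ioo_rpow_iff h]
      linarith
  refine h1.congr_fun (fun y hy => ?_) measurableSet_Ioo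
  rw [finrank_euclideanSpace_fin, smul_eq_mul, pow_pred_mul_rpow hN e hy.1]

theorem setIntegral_ball_norm_rpow {N : ℕ} (hN : 0 < N) {e ρ : ℝ} (he : -(N : ℝ) < e)
    (hρ : 0 < ρ) :
    ∫ z in Metric.ball (0 : EuclideanSpace ℝ (Fin N)) ρ, ‖z‖ ^ e =
      unitSphereArea N * (ρ ^ (N + e) / (N + e)) := by
  have := nontrivial_euclideanSpace hN
  rw [← integral_indicator Metric.isOpen_ball.measurableSet,
    indicator_ball_norm ρ (fun r => r ^ e),
    integral_fun_norm_addHaar volume ((Set.Iio ρ).indicator (fun r : ℝ => r ^ e))]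
  rw [finrank_euclideanSpace_fin, unitSphereArea, nsmul_eq_mul, smul_eq_mul, mul_assoc]
  congr 2
  calc ∫ y in Set.Ioi (0 : ℝ), y ^ (N - 1) • (Set.Iio ρ).indicator (fun r : ℝ => r ^ e) y
      = ∫ y in Set.Ioi (0 : ℝ), (Set.Iio ρ).indicator (fun r : ℝ => r ^ ((N : ℝ) - 1 + e)) y := by
        refine setIntegral_congr_fun measurableSet_Ioi (fun y hy => ?_)
        by_cases h : y < ρ
        · simp [h, pow_pred_mul_rpow hN e hy]
        · simp [h]
    _ = ∫ y in (0 : ℝ)..ρ, y ^ ((N : ℝ) - 1 + e) := by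
        rw [setIntegral_indicator measurableSet_Iio, Set.Ioi_inter_Iio,
          intervalIntegral.integral_of_le hρ.le, integral_Ioc_eq_integral_Ioo]
    _ = ρ ^ (N + e) / (N + e) := by
        rw [integral_rpow (Or.inl (by linarith)), Real.zero_rpow (by linarith), sub_zero]
        ring_nf

theorem setIntegral_add_left {N : ℕ} (x : EuclideanSpace ℝ (Fin N)) (r : ℝ)
    (F : EuclideanSpace ℝ (Fin N) → ℝ) :
    ∫ y in (Metric.ball x r)ᶜ, F y = ∫ z in (Metric.ball 0 r)ᶜ, F (x + z) := by
  have h := (measurePreserving_add_left volume x).setIntegral_preimage_emb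
    (measurableEmbedding_addLeft x) F (Metric.ball x r)ᶜ
  rw [← h]
  congr 2
  ext z
  simp

theorem integrableOn_add_left_iff {N : ℕ} (x : EuclideanSpace ℝ (Fin N)) (r : ℝ)
    (F : EuclideanSpace ℝ (Fin N) → ℝ) :
    IntegrableOn F (Metric.ball x r)ᶜ ↔ IntegrableOn (fun z => F (x + z)) (Metric.ball 0 r)ᶜ := by
  have h := (measurePreserving_add_left volume x).integrableOn_comp_preimage
    (measurableEmbedding_addLeft x) (f := F) (s := (Metric.ball x r)ᶜ)
  rw [← h]
  have : (fun y => x + y) ⁻¹' (Metric.ball x r)ᶜ = (Metric.ball 0 r)ᶜ := by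
    ext z
    simp
  rw [this]
  rfl

/-- The integrand is odd under z ↦ -z. This removes the first-order term from the singular
integrals. -/
theorem setIntegral_inner_mul_norm_eq_zero {N : ℕ} (b : EuclideanSpace ℝ (Fin N)) (g : ℝ → ℝ)
    (I : Set ℝ) :
    ∫ z in {z : EuclideanSpace ℝ (Fin N) | ‖z‖ ∈ I}, inner ℝ b z * g ‖z‖ = 0 := by
  set A := {z : EuclideanSpace ℝ (Fin N) | ‖z‖ ∈ I}
  have h := (Measure.measurePreserving_neg (volume : Measure (EuclideanSpace ℝ (Fin N))))
    |>.setIntegral_preimage_emb (MeasurableEquiv.neg _).measurableEmbedding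
      (fun z => inner ℝ b z * g ‖z‖) A
  have hA : (Neg.neg ⁻¹' A) = A := by ext z; simp [A]
  change ∫ z in (Neg.neg ⁻¹' A), inner ℝ b (-z) * g ‖-z‖ = _ at h
  rw [hA] at h
  simp only [inner_neg_right, norm_neg, neg_mul, integral_neg] at h
  linarith

/-! ### The Riesz power |x|^(-(N-2s)): its truncated singular integrals. -/

/-- Convexity of t ↦ t^(-a): the graph lies above its tangent at t₀. -/
theorem rpow_neg_tangent_le {a t₀ t : ℝ} (ha : 0 ≤ a) (h₀ : 0 < t₀) (ht : 0 < t) :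
    t₀ ^ (-a) - t ^ (-a) ≤ a * t₀ ^ (-a - 1) * (t - t₀) := by
  have hτ : 0 < t / t₀ := div_pos ht h₀
  have h1 : 1 - a * (t / t₀ - 1) ≤ (t / t₀) ^ (-a) := by
    rw [Real.rpow_def_of_pos hτ]
    have h2 := Real.add_one_le_exp (Real.log (t / t₀) * -a)
    have h3 := Real.log_le_sub_one_of_pos hτ
    nlinarith
  have h4 : t ^ (-a) = t₀ ^ (-a) * (t / t₀) ^ (-a) := by
    rw [← Real.mul_rpow h₀.le hτ.le, mul_div_cancel₀ _ h₀.ne']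
  have h5 : t₀ ^ (-a - 1) = t₀ ^ (-a) / t₀ := by
    rw [Real.rpow_sub h₀, Real.rpow_one]
  have h6 : 0 < t₀ ^ (-a) := Real.rpow_pos_of_pos h₀ _
  rw [h4, h5]
  have : a * (t₀ ^ (-a) / t₀) * (t - t₀) = t₀ ^ (-a) * (a * (t / t₀ - 1)) := by
    field_simp
  rw [this]
  nlinarith [mul_le_mul_of_nonneg_left h1 h6.le]

theorem integrableOn_compl_ball_inv_norm_sub_rpow {N : ℕ} (hN : 0 < N) {m ρ : ℝ} (hm : (N : ℝ) < m)
    (hρ : 0 < ρ) (x : EuclideanSpace ℝ (Fin N)) :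
    IntegrableOn (fun y => 1 / ‖x - y‖ ^ m) (Metric.ball x ρ)ᶜ := by
  rw [integrableOn_add_left_iff]
  refine (integrableOn_compl_ball_norm_rpow hN (e := -m) (by linarith) hρ).congr_fun
    (fun z _ => ?_) Metric.isOpen_ball.measurableSet.compl
  simp only [sub_add_cancel_left, norm_neg]
  rw [Real.rpow_neg (norm_nonneg _), one_div]

theorem integrableOn_riesz_kernel {N : ℕ} (hN : 0 < N) {a m ε : ℝ} (ha : 0 ≤ a) (haN : a < N)
    (hm : (N : ℝ) < m) (hε : 0 < ε) (x : EuclideanSpace ℝ (Fin N)) :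
    IntegrableOn (fun y => ‖y‖ ^ (-a) / ‖x - y‖ ^ m) (Metric.ball x ε)ᶜ := by
  have hm0 : 0 < m := lt_of_le_of_lt (Nat.cast_nonneg N) hm
  have h1 := integrableOn_compl_ball_inv_norm_sub_rpow hN hm hε x
  have h2 : Integrable ((Metric.ball (0 : EuclideanSpace ℝ (Fin N)) 1).indicator
      (fun y => ‖y‖ ^ (-a))) :=
    (integrable_indicator_iff Metric.isOpen_ball.measurableSet).2
      (integrableOn_ball_norm_rpow hN (by linarith) 1)
  -- The kernel is at most ε^(-m) off the ball, which handles the singularity of |y|^(-a) at 0;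
  -- where |y| ≥ 1 that power is at most 1.
  have h3 := (h2.integrableOn (s := (Metric.ball x ε)ᶜ)).const_mul (ε ^ m)⁻¹
  refine (h3.add h1).mono' ?_ ?_
  · exact (by fun_prop : Measurable _).aestronglyMeasurable
  · refine (ae_restrict_iff' Metric.isOpen_ball.measurableSet.compl).2 (.of_forall fun y hy => ?_)
    have hy' : ε ≤ ‖x - y‖ := by
      simpa [dist_eq_norm, norm_sub_rev] using hy
    have hk : 0 < ‖x - y‖ ^ m := Real.rpow_pos_of_pos (hε.trans_le hy') _
    have hεm : 0 < ε ^ m := Real.rpow_pos_of_pos hε _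
    have hle : ε ^ m ≤ ‖x - y‖ ^ m := Real.rpow_le_rpow hε.le hy' hm0.le
    have hv : 0 ≤ ‖y‖ ^ (-a) := Real.rpow_nonneg (norm_nonneg _) _
    rw [Real.norm_of_nonneg (by positivity)]
    simp only [Pi.add_apply]
    by_cases h : ‖y‖ < 1
    · rw [Set.indicator_of_mem (by simpa using h)]
      have : ‖y‖ ^ (-a) / ‖x - y‖ ^ m ≤ (ε ^ m)⁻¹ * ‖y‖ ^ (-a) := by
        rw [mul_comm, ← div_eq_mul_inv]
        gcongr
      have : 0 ≤ 1 / ‖x - y‖ ^ m := by positivity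
      linarith
    · rw [Set.indicator_of_notMem (by simpa using h), mul_zero, zero_add]
      gcongr
      exact Real.rpow_le_one_of_one_le_of_nonpos (not_lt.1 h) (by linarith)

theorem abs_det_fderiv_inversion {N : ℕ} {r : ℝ} {y : EuclideanSpace ℝ (Fin N)} :
    |((r / dist y 0) ^ 2 • ((ℝ ∙ (y - 0))ᗮ.reflection :
      EuclideanSpace ℝ (Fin N) →L[ℝ] EuclideanSpace ℝ (Fin N))).det| =
      ((r / ‖y‖) ^ 2) ^ N := by
  rw [ContinuousLinearMap.det]
  have h : (((ℝ ∙ (y - 0))ᗮ.reflection : EuclideanSpace ℝ (Fin N) →L[ℝ] EuclideanSpace ℝ (Fin N)) :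
      EuclideanSpace ℝ (Fin N) →ₗ[ℝ] EuclideanSpace ℝ (Fin N)) =
      (ℝ ∙ (y - 0))ᗮ.reflection.toLinearMap := rfl
  rw [ContinuousLinearMap.toLinearMap_smul, h, LinearMap.det_smul, Submodule.det_reflection, abs_mul,
    abs_pow (-1 : ℝ), abs_neg, abs_one, one_pow, mul_one, finrank_euclideanSpace_fin, dist_zero_right]
  exact abs_of_nonneg (by positivity)

open EuclideanGeometry in
theorem norm_sub_inversion {N : ℕ} {x y : EuclideanSpace ℝ (Fin N)} (hx : x ≠ 0) (hy : y ≠ 0) :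
    ‖x - inversion 0 ‖x‖ y‖ = ‖x‖ / ‖y‖ * ‖x - y‖ := by
  have h := dist_inversion_inversion hx hy ‖x‖
  have hx' : inversion 0 ‖x‖ x = x := inversion_of_mem_sphere (by simp)
  have : ‖x‖ ≠ 0 := by simpa using hx
  have : ‖y‖ ≠ 0 := by simpa using hy
  simp only [hx', dist_eq_norm, sub_zero] at h
  rw [h]
  field_simp

-- Kelvin transform in the sphere of radius |x|, which fixes x. With t = |x|/|y| the Jacobian t^(2N)
-- splits as t^(N-2s) t^(N+2s): one factor cancels the change of the kernel, the other turns the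
-- difference of powers into its negative.
open EuclideanGeometry in
theorem jacobian_mul_riesz_integrand_inversion {N : ℕ} {s : ℝ} {x y : EuclideanSpace ℝ (Fin N)}
    (hx : x ≠ 0) (hy : y ≠ 0) :
    ((‖x‖ / ‖y‖) ^ 2) ^ N * ((‖x‖ ^ (-((N : ℝ) - 2 * s)) -
        ‖inversion 0 ‖x‖ y‖ ^ (-((N : ℝ) - 2 * s))) /
          ‖x - inversion 0 ‖x‖ y‖ ^ ((N : ℝ) + 2 * s)) =
      -((‖x‖ ^ (-((N : ℝ) - 2 * s)) - ‖y‖ ^ (-((N : ℝ) - 2 * s))) /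
          ‖x - y‖ ^ ((N : ℝ) + 2 * s)) := by
  rw [norm_sub_inversion hx hy]
  have h1 : ‖inversion 0 ‖x‖ y‖ = ‖x‖ * (‖x‖ / ‖y‖) := by
    have := dist_inversion_center 0 y ‖x‖
    rw [dist_zero_right, dist_zero_right] at this
    rw [this]
    ring
  have hr : 0 < ‖x‖ := norm_pos_iff.2 hx
  have hy0 : 0 < ‖y‖ := norm_pos_iff.2 hy
  set t := ‖x‖ / ‖y‖ with ht
  have ht0 : 0 < t := div_pos hr hy0
  have h2 : ‖y‖ = ‖x‖ * t⁻¹ := by rw [ht]; field_simp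
  rw [h1, h2, Real.mul_rpow hr.le ht0.le, Real.mul_rpow hr.le (by positivity),
    Real.mul_rpow ht0.le (norm_nonneg _), Real.inv_rpow ht0.le, Real.rpow_neg ht0.le, inv_inv]
  have h3 : (t ^ 2) ^ N = t ^ ((N : ℝ) - 2 * s) * t ^ ((N : ℝ) + 2 * s) := by
    rw [← Real.rpow_add ht0, ← pow_mul, ← Real.rpow_natCast]
    push_cast
    ring_nf
  rw [h3]
  have : 0 < t ^ ((N : ℝ) - 2 * s) := Real.rpow_pos_of_pos ht0 _
  have : 0 < t ^ ((N : ℝ) + 2 * s) := Real.rpow_pos_of_pos ht0 _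
  field_simp
  ring

theorem abs_norm_rpow_neg_sub_le {N : ℕ} {a : ℝ} (ha : 0 ≤ a) {x y : EuclideanSpace ℝ (Fin N)}
    (hx : x ≠ 0) (hxy : ‖x - y‖ ≤ ‖x‖ / 2) :
    |‖x‖ ^ (-a) - ‖y‖ ^ (-a)| ≤ a * (‖x‖ / 2) ^ (-a - 1) * ‖x - y‖ := by
  have hr : 0 < ‖x‖ := norm_pos_iff.2 hx
  have h1 : ‖x‖ - ‖y‖ ≤ ‖x - y‖ := norm_sub_norm_le x y
  have h2 : ‖y‖ - ‖x‖ ≤ ‖x - y‖ := by rw [norm_sub_rev]; exact norm_sub_norm_le y x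
  have hy : ‖x‖ / 2 ≤ ‖y‖ := by linarith
  have hmono : ∀ t, ‖x‖ / 2 ≤ t → t ^ (-a - 1) ≤ (‖x‖ / 2) ^ (-a - 1) := fun t ht =>
    Real.rpow_le_rpow_of_nonpos (by positivity) ht (by linarith)
  have key : ∀ t₀ t : ℝ, ‖x‖ / 2 ≤ t₀ → 0 < t → t - t₀ ≤ ‖x - y‖ →
      t₀ ^ (-a) - t ^ (-a) ≤ a * (‖x‖ / 2) ^ (-a - 1) * ‖x - y‖ := by
    intro t₀ t h0 ht htt
    have ht0 : 0 < t₀ := by linarith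
    have hp : 0 ≤ t₀ ^ (-a - 1) := by positivity
    calc _ ≤ a * t₀ ^ (-a - 1) * (t - t₀) := rpow_neg_tangent_le ha ht0 ht
      _ ≤ a * t₀ ^ (-a - 1) * ‖x - y‖ := by gcongr
      _ ≤ _ := mul_le_mul_of_nonneg_right (mul_le_mul_of_nonneg_left (hmono _ h0) ha)
          (norm_nonneg _)
  rw [abs_le]
  constructor
  · linarith [key ‖y‖ ‖x‖ hy hr h1]
  · exact key ‖x‖ ‖y‖ (by linarith) (by linarith) h2

open EuclideanGeometry in
theorem image_inversion_setOf_far {N : ℕ} {x : EuclideanSpace ℝ (Fin N)} (hx : x ≠ 0) (ε : ℝ) :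
    inversion 0 ‖x‖ '' {y | y ≠ 0 ∧ ε * ‖y‖ ≤ ‖x‖ * ‖x - y‖} = (Metric.ball x ε)ᶜ \ {0} := by
  have hr : 0 < ‖x‖ := norm_pos_iff.2 hx
  have key : ∀ y : EuclideanSpace ℝ (Fin N), y ≠ 0 →
      (ε ≤ ‖x - inversion 0 ‖x‖ y‖ ↔ ε * ‖y‖ ≤ ‖x‖ * ‖x - y‖) := by
    intro y hy
    have hy0 : 0 < ‖y‖ := norm_pos_iff.2 hy
    rw [norm_sub_inversion hx hy, div_mul_eq_mul_div, le_div_iff₀ hy0]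
  ext y
  simp only [Set.mem_image, Set.mem_ofPred_eq, Set.mem_sdiff, Set.mem_compl_iff, Metric.mem_ball,
    not_lt, Set.mem_singleton_iff]
  rw [dist_comm, dist_eq_norm]
  constructor
  · rintro ⟨w, ⟨hw0, hw⟩, rfl⟩
    exact ⟨(key w hw0).2 hw, by simpa [inversion_eq_center hr.ne'] using hw0⟩
  · rintro ⟨h, h0⟩
    have h0' : inversion 0 ‖x‖ y ≠ 0 := by simpa [inversion_eq_center hr.ne'] using h0
    refine ⟨inversion 0 ‖x‖ y, ⟨h0', ?_⟩, inversion_inversion 0 hr.ne' y⟩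
    rw [← key _ h0', inversion_inversion 0 hr.ne' y]
    exact h

theorem measurableSet_setOf_far {N : ℕ} (x : EuclideanSpace ℝ (Fin N)) (ε : ℝ) :
    MeasurableSet {y : EuclideanSpace ℝ (Fin N) | y ≠ 0 ∧ ε * ‖y‖ ≤ ‖x‖ * ‖x - y‖} :=
  (measurableSet_singleton 0).compl.inter
    (measurableSet_le (f := fun y => ε * ‖y‖) (g := fun y => ‖x‖ * ‖x - y‖) (by fun_prop)
      (by fun_prop))

theorem integrableOn_riesz_integrand {N : ℕ} (hN0 : 0 < N) {s : ℝ} (hs : 0 < s)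
    (hN : 2 * s < (N : ℝ)) {ε : ℝ} (hε : 0 < ε) (x : EuclideanSpace ℝ (Fin N)) :
    IntegrableOn (fun y => (‖x‖ ^ (-((N : ℝ) - 2 * s)) - ‖y‖ ^ (-((N : ℝ) - 2 * s))) /
      ‖x - y‖ ^ ((N : ℝ) + 2 * s)) (Metric.ball x ε)ᶜ := by
  have h1 := integrableOn_compl_ball_inv_norm_sub_rpow hN0 (m := N + 2 * s) (by linarith) hε x
  have h2 := integrableOn_riesz_kernel hN0 (a := N - 2 * s) (m := N + 2 * s) (by linarith)
    (by linarith) (by linarith) hε x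
  refine ((h1.const_mul (‖x‖ ^ (-((N : ℝ) - 2 * s)))).sub h2).congr (.of_forall fun y => ?_)
  simp only [Pi.sub_apply]
  ring

-- The exterior of the ball around x is the image, up to the origin, of a slightly distorted
-- exterior, and the integrand changes sign. The integral is therefore antisymmetric up to the
-- discrepancy between the two domains.
open EuclideanGeometry in
theorem setIntegral_riesz_integrand_inversion {N : ℕ} (hN0 : 0 < N) {s : ℝ} (hs : 0 < s)
    (hN : 2 * s < (N : ℝ)) {ε : ℝ} (hε : 0 < ε) {x : EuclideanSpace ℝ (Fin N)} (hx : x ≠ 0) :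
    IntegrableOn (fun y => (‖x‖ ^ (-((N : ℝ) - 2 * s)) - ‖y‖ ^ (-((N : ℝ) - 2 * s))) /
      ‖x - y‖ ^ ((N : ℝ) + 2 * s)) {y | y ≠ 0 ∧ ε * ‖y‖ ≤ ‖x‖ * ‖x - y‖} ∧
    ∫ y in (Metric.ball x ε)ᶜ \ {0},
      (‖x‖ ^ (-((N : ℝ) - 2 * s)) - ‖y‖ ^ (-((N : ℝ) - 2 * s))) / ‖x - y‖ ^ ((N : ℝ) + 2 * s) =
    -∫ y in {y | y ≠ 0 ∧ ε * ‖y‖ ≤ ‖x‖ * ‖x - y‖},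
      (‖x‖ ^ (-((N : ℝ) - 2 * s)) - ‖y‖ ^ (-((N : ℝ) - 2 * s))) /
        ‖x - y‖ ^ ((N : ℝ) + 2 * s) := by
  set G : EuclideanSpace ℝ (Fin N) → ℝ := fun y =>
    (‖x‖ ^ (-((N : ℝ) - 2 * s)) - ‖y‖ ^ (-((N : ℝ) - 2 * s))) / ‖x - y‖ ^ ((N : ℝ) + 2 * s) with hG
  set D : Set (EuclideanSpace ℝ (Fin N)) := {y | y ≠ 0 ∧ ε * ‖y‖ ≤ ‖x‖ * ‖x - y‖} with hD
  have hr : ‖x‖ ≠ 0 := by simpa using hx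
  have hDm : MeasurableSet D := measurableSet_setOf_far x ε
  have hf : ∀ y ∈ D, HasFDerivWithinAt (inversion 0 ‖x‖)
      ((‖x‖ / dist y 0) ^ 2 • ((ℝ ∙ (y - 0))ᗮ.reflection :
        EuclideanSpace ℝ (Fin N) →L[ℝ] EuclideanSpace ℝ (Fin N))) D y := fun y hy =>
    (hasFDerivAt_inversion hy.1).hasFDerivWithinAt
  have hinj : Set.InjOn (inversion (0 : EuclideanSpace ℝ (Fin N)) ‖x‖) D :=
    (inversion_injective 0 hr).injOn
  have hcongr : ∀ y ∈ D, |((‖x‖ / dist y 0) ^ 2 • ((ℝ ∙ (y - 0))ᗮ.reflection :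
        EuclideanSpace ℝ (Fin N) →L[ℝ] EuclideanSpace ℝ (Fin N))).det| •
        G (inversion 0 ‖x‖ y) = -G y := by
    intro y hy
    rw [abs_det_fderiv_inversion, smul_eq_mul]
    exact jacobian_mul_riesz_integrand_inversion hx hy.1
  have h1 := integrableOn_image_iff_integrableOn_abs_det_fderiv_smul volume hDm hf hinj G
  have h2 := integral_image_eq_integral_abs_det_fderiv_smul volume hDm hf hinj G
  rw [image_inversion_setOf_far hx, setIntegral_congr_fun hDm hcongr, integral_neg] at h2
  rw [image_inversion_setOf_far hx, integrableOn_congr_fun hcongr hDm] at h1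
  refine ⟨?_, h2⟩
  have h3 := (h1.1 ((integrableOn_riesz_integrand hN0 hs hN hε x).mono_set Set.sdiff_subset)).neg
  simpa [Pi.neg_def] using h3

theorem indicator_sub_indicator_le {X : Type*} {A B S : Set X} {G H : X → ℝ}
    (hS : ∀ y, (y ∈ A ∧ y ∉ B) ∨ (y ∈ B ∧ y ∉ A) → y ∈ S) (hG : ∀ y ∈ S, |G y| ≤ H y)
    (y : X) : A.indicator G y - B.indicator G y ≤ S.indicator H y := by
  by_cases hA : y ∈ A <;> by_cases hB : y ∈ B
  · by_cases h : y ∈ S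
    · simpa [hA, hB, h] using (abs_nonneg _).trans (hG y h)
    · simp [hA, hB, h]
  · have h := hS y (Or.inl ⟨hA, hB⟩)
    simpa [hA, hB, h] using (le_abs_self _).trans (hG y h)
  · have h := hS y (Or.inr ⟨hB, hA⟩)
    simpa [hA, hB, h] using (neg_le_abs _).trans (hG y h)
  · by_cases h : y ∈ S
    · simpa [hA, hB, h] using (abs_nonneg _).trans (hG y h)
    · simp [hA, hB, h]

theorem setIntegral_annulus_norm_sub_rpow {N : ℕ} (hN0 : 0 < N) {e ρ₁ ρ₂ : ℝ} (he : e < -N)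
    (hρ : 0 < ρ₁) (hρ' : ρ₁ ≤ ρ₂) (x : EuclideanSpace ℝ (Fin N)) :
    IntegrableOn (fun y => ‖x - y‖ ^ e) (Metric.ball x ρ₂ \ Metric.ball x ρ₁) ∧
    ∫ y in Metric.ball x ρ₂ \ Metric.ball x ρ₁, ‖x - y‖ ^ e =
      unitSphereArea N * ((ρ₁ ^ (N + e) - ρ₂ ^ (N + e)) / -(N + e)) := by
  have hI : ∀ ρ, 0 < ρ → IntegrableOn (fun y => ‖x - y‖ ^ e) (Metric.ball x ρ)ᶜ := by
    intro ρ h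
    rw [integrableOn_add_left_iff]
    simpa using integrableOn_compl_ball_norm_rpow hN0 he h
  have hV : ∀ ρ, 0 < ρ → ∫ y in (Metric.ball x ρ)ᶜ, ‖x - y‖ ^ e =
      unitSphereArea N * (ρ ^ (N + e) / -(N + e)) := by
    intro ρ h
    rw [setIntegral_add_left]
    simpa using setIntegral_compl_ball_norm_rpow hN0 he h
  have hset : Metric.ball x ρ₂ \ Metric.ball x ρ₁ = (Metric.ball x ρ₁)ᶜ \ (Metric.ball x ρ₂)ᶜ := by
    ext y; simp [and_comm]
  rw [hset]
  refine ⟨(hI ρ₁ hρ).mono_set Set.sdiff_subset, ?_⟩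
  rw [setIntegral_sdiff Metric.isOpen_ball.measurableSet.compl (hI ρ₁ hρ)
    (Set.compl_subset_compl.2 (Metric.ball_subset_ball hρ')), hV ρ₁ hρ, hV ρ₂ (hρ.trans_le hρ')]
  ring

/-- The shell has thickness of order ε²/r; the bound shows what this thickness gains once the
first-order singularity is integrated over it. -/
theorem rpow_shell_difference_le {γ ε r : ℝ} (hγ : γ ≤ 1) (hε : 0 < ε)
    (hεr : ε < r) :
    (ε / (1 + ε / r)) ^ (-γ) - (ε / (1 - ε / r)) ^ (-γ) ≤ 2 / r * ε ^ (1 - γ) := by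
  have hr : 0 < r := hε.trans hεr
  have hτ : 0 < ε / r := div_pos hε hr
  have hτ1 : ε / r < 1 := (div_lt_one hr).2 hεr
  set τ := ε / r with hτdef
  have h1 : (1 + τ) ^ γ ≤ 1 + τ := by
    simpa using Real.rpow_le_rpow_of_exponent_le (by linarith : 1 ≤ 1 + τ) hγ
  have h2 : 1 - τ ≤ (1 - τ) ^ γ := by
    simpa using Real.rpow_le_rpow_of_exponent_ge (by linarith : 0 < 1 - τ) (by linarith) hγ
  rw [Real.div_rpow hε.le (by linarith), Real.div_rpow hε.le (by linarith),
    Real.rpow_neg (by linarith : 0 ≤ 1 + τ), Real.rpow_neg (by linarith : 0 ≤ 1 - τ),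
    div_inv_eq_mul, div_inv_eq_mul, Real.rpow_sub hε, Real.rpow_one, Real.rpow_neg hε.le]
  have hp : 0 < (ε ^ γ)⁻¹ := inv_pos.2 (Real.rpow_pos_of_pos hε _)
  calc (ε ^ γ)⁻¹ * (1 + τ) ^ γ - (ε ^ γ)⁻¹ * (1 - τ) ^ γ
      = (ε ^ γ)⁻¹ * ((1 + τ) ^ γ - (1 - τ) ^ γ) := by ring
    _ ≤ (ε ^ γ)⁻¹ * (2 * τ) := by gcongr; linarith
    _ = _ := by rw [hτdef]; field_simp

/-- Twice the integral is the difference of the integrals over the exterior of the ball and over its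
inverted copy. These differ only inside a thin shell around |x - y| = ε, where the Lipschitz bound
on the power gives O(ε^(2-2s)). Only this upper bound is needed, since the principal value of u is
assumed to exist. -/
theorem setIntegral_riesz_integrand_le {N : ℕ} (hN0 : 0 < N) {s : ℝ} (hs₁ : 1 / 2 < s)
    (hs₂ : s < 1) (hN : 2 * s < (N : ℝ)) {x : EuclideanSpace ℝ (Fin N)} (hx : x ≠ 0) :
    ∃ K : ℝ, ∀ ε, 0 < ε → ε ≤ ‖x‖ / 3 →
      ∫ y in (Metric.ball x ε)ᶜ, (‖x‖ ^ (-((N : ℝ) - 2 * s)) - ‖y‖ ^ (-((N : ℝ) - 2 * s))) /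
        ‖x - y‖ ^ ((N : ℝ) + 2 * s) ≤ K * ε ^ (2 - 2 * s) := by
  have hr : 0 < ‖x‖ := norm_pos_iff.2 hx
  set a : ℝ := (N : ℝ) - 2 * s with ha
  set Λ : ℝ := a * (‖x‖ / 2) ^ (-a - 1) with hΛ
  have ha0 : 0 < a := by rw [ha]; linarith
  have hΛ0 : 0 ≤ Λ := by positivity
  -- The final 1/2 comes from the antisymmetry under inversion.
  refine ⟨Λ * (unitSphereArea N * (2 / ‖x‖ / (2 * s - 1))) / 2, fun ε hε hεr => ?_⟩
  set G : EuclideanSpace ℝ (Fin N) → ℝ := fun y =>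
    (‖x‖ ^ (-a) - ‖y‖ ^ (-a)) / ‖x - y‖ ^ ((N : ℝ) + 2 * s) with hG
  set D : Set (EuclideanSpace ℝ (Fin N)) := {y | y ≠ 0 ∧ ε * ‖y‖ ≤ ‖x‖ * ‖x - y‖} with hD
  set D₀ : Set (EuclideanSpace ℝ (Fin N)) := (Metric.ball x ε)ᶜ \ {0} with hD₀
  obtain ⟨hDi, hint⟩ := setIntegral_riesz_integrand_inversion hN0 (by linarith) hN hε hx
  have hD₀i : IntegrableOn G D₀ :=
    (integrableOn_riesz_integrand hN0 (by linarith) hN hε x).mono_set Set.sdiff_subset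
  have hDm : MeasurableSet D := measurableSet_setOf_far x ε
  have hD₀m : MeasurableSet D₀ :=
    Metric.isOpen_ball.measurableSet.compl.diff (measurableSet_singleton _)
  have := nontrivial_euclideanSpace hN0
  have hae : ∫ y in (Metric.ball x ε)ᶜ, G y = ∫ y in D₀, G y :=
    (setIntegral_congr_set (sdiff_null_ae_eq_self (measure_singleton 0))).symm
  set τ : ℝ := ε / ‖x‖ with hτ
  have hτ0 : 0 < τ := by positivity
  have hτ3 : τ ≤ 1 / 3 := by rw [hτ, div_le_iff₀ hr]; linarith
  have hετ : ε = τ * ‖x‖ := by rw [hτ]; field_simp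
  set ρ₁ : ℝ := ε / (1 + τ) with hρ₁
  set ρ₂ : ℝ := ε / (1 - τ) with hρ₂
  have hρ₁0 : 0 < ρ₁ := by positivity
  have hρ₁ε : ρ₁ ≤ ε := div_le_self hε.le (by linarith)
  have hερ₂ : ε ≤ ρ₂ := by
    rw [hρ₂, le_div_iff₀ (by linarith)]; nlinarith
  have hρ₂r : ρ₂ ≤ ‖x‖ / 2 := by
    rw [hρ₂, div_le_iff₀ (by linarith)]; nlinarith
  set S : Set (EuclideanSpace ℝ (Fin N)) := Metric.ball x ρ₂ \ Metric.ball x ρ₁ with hS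
  have hSm : MeasurableSet S := Metric.isOpen_ball.measurableSet.diff Metric.isOpen_ball.measurableSet
  have hmemS : ∀ y, y ∈ S ↔ ‖x - y‖ < ρ₂ ∧ ρ₁ ≤ ‖x - y‖ := by
    intro y; simp [hS, dist_eq_norm, norm_sub_rev]
  have he : (1 : ℝ) - (N + 2 * s) < -N := by linarith
  obtain ⟨hSi, hSv⟩ := setIntegral_annulus_norm_sub_rpow hN0 he hρ₁0 (hρ₁ε.trans hερ₂) x
  have hdiff : ∀ y, (y ∈ D₀ ∧ y ∉ D) ∨ (y ∈ D ∧ y ∉ D₀) → y ∈ S := by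
    intro y h
    rw [hmemS]
    have hd : y ∈ D₀ ↔ ε ≤ ‖x - y‖ ∧ y ≠ 0 := by
      simp [hD₀, dist_eq_norm, norm_sub_rev]
    have h1 : ‖y‖ ≤ ‖x‖ + ‖x - y‖ := by
      have := norm_sub_norm_le y x
      rw [norm_sub_rev] at this; linarith
    have h2 : ‖x‖ ≤ ‖y‖ + ‖x - y‖ := by
      have := norm_sub_norm_le x y
      linarith
    rw [hd] at h
    simp only [hD, Set.mem_ofPred_eq, hετ] at h
    rw [hρ₁, hρ₂, lt_div_iff₀ (by linarith), div_le_iff₀ (by linarith), hετ]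
    rcases h with ⟨⟨h3, h4⟩, h5⟩ | ⟨⟨h3, h4⟩, h5⟩
    · have h6 : ‖x‖ * ‖x - y‖ < ‖x‖ * (τ * ‖y‖) := by
        by_contra! hc
        exact h5 ⟨h4, by linarith⟩
      have h7 := lt_of_mul_lt_mul_left h6 hr.le
      constructor <;> nlinarith
    · have h6 : ‖x - y‖ < τ * ‖x‖ := by
        by_contra! hc
        exact h5 ⟨hc, h3⟩
      have h7 : τ * ‖y‖ ≤ ‖x - y‖ := by
        refine le_of_mul_le_mul_left ?_ hr
        linarith
      constructor <;> nlinarith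
  have hGS : ∀ y ∈ S, |G y| ≤ Λ * ‖x - y‖ ^ (1 - ((N : ℝ) + 2 * s)) := by
    intro y hy
    rw [hmemS] at hy
    have hd : 0 < ‖x - y‖ := hρ₁0.trans_le hy.2
    have hk : 0 < ‖x - y‖ ^ ((N : ℝ) + 2 * s) := Real.rpow_pos_of_pos hd _
    rw [hG, abs_div, abs_of_pos hk, Real.rpow_sub hd, Real.rpow_one, ← mul_div_assoc]
    gcongr
    exact abs_norm_rpow_neg_sub_le ha0.le hx (hy.1.le.trans hρ₂r)
  have hmain : ∫ y, (D₀.indicator G y - D.indicator G y) ≤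
      ∫ y, S.indicator (fun y => Λ * ‖x - y‖ ^ (1 - ((N : ℝ) + 2 * s))) y := by
    refine integral_mono ?_ ?_ (indicator_sub_indicator_le hdiff hGS)
    · exact ((integrable_indicator_iff hD₀m).2 hD₀i).sub ((integrable_indicator_iff hDm).2 hDi)
    · exact (integrable_indicator_iff hSm).2 (hSi.const_mul Λ)
  rw [integral_sub ((integrable_indicator_iff hD₀m).2 hD₀i) ((integrable_indicator_iff hDm).2 hDi),
    integral_indicator hD₀m, integral_indicator hDm, integral_indicator hSm, integral_const_mul,
    hSv] at hmain
  have hexp : (N : ℝ) + (1 - (N + 2 * s)) = -(2 * s - 1) := by ring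
  have hshell := rpow_shell_difference_le (γ := 2 * s - 1) (r := ‖x‖) (by linarith) hε
    (by linarith)
  rw [hexp, neg_neg] at hmain
  have hA := (unitSphereArea_pos hN0).le
  have hfin : Λ * (unitSphereArea N * ((ρ₁ ^ (-(2 * s - 1)) - ρ₂ ^ (-(2 * s - 1))) / (2 * s - 1))) ≤
      Λ * (unitSphereArea N * (2 / ‖x‖ * ε ^ (1 - (2 * s - 1)) / (2 * s - 1))) := by
    have : 0 < 2 * s - 1 := by linarith
    gcongr
  rw [hae]
  have hint' : ∫ y in D₀, G y = -∫ y in D, G y := hint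
  have he2 : (1 : ℝ) - (2 * s - 1) = 2 - 2 * s := by ring
  rw [he2] at hfin
  have : Λ * (unitSphereArea N * (2 / ‖x‖ / (2 * s - 1))) / 2 * ε ^ (2 - 2 * s) =
    Λ * (unitSphereArea N * (2 / ‖x‖ * ε ^ (2 - 2 * s) / (2 * s - 1))) / 2 := by ring
  rw [this]
  linarith

/-! ### The fractional Laplacian and the gradient at a touching point. -/

theorem integrableOn_fracLaplacian_integrand {N : ℕ} (hN0 : 0 < N) {s : ℝ} (hs : 0 < s)
    {u : EuclideanSpace ℝ (Fin N) → ℝ} (hu : MemL2s N s u) {ε : ℝ} (hε : 0 < ε)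
    (x : EuclideanSpace ℝ (Fin N)) :
    IntegrableOn (fun y => (u x - u y) / ‖x - y‖ ^ ((N : ℝ) + 2 * s)) (Metric.ball x ε)ᶜ := by
  set m : ℝ := (N : ℝ) + 2 * s with hm
  have hm0 : 0 < m := by positivity
  have h1 := integrableOn_compl_ball_inv_norm_sub_rpow hN0 (m := m) (by linarith) hε x
  have hu' : Integrable (fun y => u y / (1 + ‖y‖ ^ m)) := hu
  -- K is chosen so that 1 + |y|^m ≤ K|x - y|^m when |x - y| ≥ ε; the summands bound 1 and |y|^m
  -- separately.
  set K : ℝ := (ε⁻¹) ^ m + (‖x‖ / ε + 1) ^ m with hK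
  have h2 : IntegrableOn (fun y => u y / (1 + ‖y‖ ^ m) * ((1 + ‖y‖ ^ m) / ‖x - y‖ ^ m))
      (Metric.ball x ε)ᶜ := by
    refine ((hu'.norm.const_mul K).integrableOn (s := (Metric.ball x ε)ᶜ)).mono' ?_ ?_
    · exact (hu'.aestronglyMeasurable.mul
        (by fun_prop : Measurable fun y => (1 + ‖y‖ ^ m) / ‖x - y‖ ^ m).aestronglyMeasurable).restrict
    · refine (ae_restrict_iff' Metric.isOpen_ball.measurableSet.compl).2 (.of_forall fun y hy => ?_)
      have hy' : ε ≤ ‖x - y‖ := by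
        simpa [dist_eq_norm, norm_sub_rev] using hy
      have hd : 0 < ‖x - y‖ := hε.trans_le hy'
      have hk : 0 < ‖x - y‖ ^ m := Real.rpow_pos_of_pos hd _
      rw [norm_mul, mul_comm]
      refine mul_le_mul_of_nonneg_right ?_ (norm_nonneg _)
      rw [Real.norm_of_nonneg (by positivity), div_le_iff₀ hk, hK, add_mul,
        ← Real.mul_rpow (by positivity) hd.le, ← Real.mul_rpow (by positivity) hd.le]
      gcongr ?_ + ?_
      · refine Real.one_le_rpow ?_ hm0.le
        rw [inv_mul_eq_div, one_le_div hε]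
        exact hy'
      · refine Real.rpow_le_rpow (norm_nonneg _) ?_ hm0.le
        have h3 := norm_sub_norm_le y x
        rw [norm_sub_rev] at h3
        have h4 : ‖x‖ ≤ ‖x‖ / ε * ‖x - y‖ := by
          rw [div_mul_eq_mul_div, le_div_iff₀ hε]
          gcongr
        linarith
  refine ((h1.const_mul (u x)).sub h2).congr (.of_forall fun y => ?_)
  have : 0 < 1 + ‖y‖ ^ m := by positivity
  simp only [Pi.sub_apply]
  field_simp

/-- A one-sided bound suffices: it bounds the derivative below in the directions v and -v. -/
theorem norm_gradient_le_of_eventually_sub_le {N : ℕ} {u : EuclideanSpace ℝ (Fin N) → ℝ}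
    {x : EuclideanSpace ℝ (Fin N)} (hu : DifferentiableAt ℝ u x) {K : ℝ} (hK : 0 ≤ K)
    (h : ∀ᶠ y in 𝓝 x, u x - u y ≤ K * ‖x - y‖) : ‖gradient u x‖ ≤ K := by
  have key : ∀ v, -(K * ‖v‖) ≤ fderiv ℝ u x v := by
    intro v
    have h1 := (hu.hasFDerivAt.hasLineDerivAt v).tendsto_slope_zero_right
    refine ge_of_tendsto h1 ?_
    have h2 : Tendsto (fun t : ℝ => x + t • v) (𝓝[>] 0) (𝓝 x) := by
      have : Tendsto (fun t : ℝ => x + t • v) (𝓝 0) (𝓝 (x + (0 : ℝ) • v)) :=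
        Continuous.tendsto (by fun_prop) 0
      rw [zero_smul, add_zero] at this
      exact this.mono_left nhdsWithin_le_nhds
    filter_upwards [h2.eventually h, self_mem_nhdsWithin] with t ht ht0
    have ht0' : 0 < t := ht0
    rw [sub_add_cancel_left, norm_neg, norm_smul, Real.norm_of_nonneg ht0'.le] at ht
    rw [smul_eq_mul, inv_mul_eq_div, le_div_iff₀ ht0']
    linarith
  have h3 : ‖gradient u x‖ = ‖fderiv ℝ u x‖ := by
    simp [gradient]
  rw [h3]
  refine ContinuousLinearMap.opNorm_le_bound _ hK fun v => ?_
  rw [Real.norm_eq_abs, abs_le]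
  refine ⟨key v, ?_⟩
  have := key (-v)
  rw [map_neg, norm_neg] at this
  linarith

theorem HasFracLaplacianAt.le_of_eventually_le {N : ℕ} {s C L b : ℝ} (hC : 0 < C)
    {u : EuclideanSpace ℝ (Fin N) → ℝ} {x : EuclideanSpace ℝ (Fin N)}
    (hL : HasFracLaplacianAt N s C u x L) {B : ℝ → ℝ} (hB : Tendsto B (𝓝[>] 0) (𝓝 b))
    (h : ∀ᶠ ε in 𝓝[>] (0 : ℝ),
      ∫ y in (Metric.ball x ε)ᶜ, (u x - u y) / ‖x - y‖ ^ ((N : ℝ) + 2 * s) ≤ B ε) :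
    L ≤ C * b := by
  refine le_of_tendsto_of_tendsto hL (hB.const_mul C) ?_
  filter_upwards [h] with ε hε
  gcongr

/-- The linear term integrates to zero by oddness, and |z|^(2-N-2s) is integrable at 0 because s <
1, so the bound is uniform in ε. -/
theorem setIntegral_annulus_le {N : ℕ} (hN0 : 0 < N) {s : ℝ} (hs₁ : 1 / 2 < s) (hs₂ : s < 1)
    {F : EuclideanSpace ℝ (Fin N) → ℝ} {b : EuclideanSpace ℝ (Fin N)} {D ρ ε : ℝ} (hD : 0 ≤ D)
    (hε : 0 < ε) (hρ : 0 < ρ)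
    (hF : IntegrableOn (fun z => F z / ‖z‖ ^ ((N : ℝ) + 2 * s)) {z | ‖z‖ ∈ Set.Ico ε ρ})
    (hle : ∀ z, ‖z‖ < ρ → F z ≤ inner ℝ b z + D * ‖z‖ ^ 2) :
    ∫ z in {z | ‖z‖ ∈ Set.Ico ε ρ}, F z / ‖z‖ ^ ((N : ℝ) + 2 * s) ≤
      D * (unitSphereArea N * (ρ ^ (2 - 2 * s) / (2 - 2 * s))) := by
  set m : ℝ := (N : ℝ) + 2 * s with hm
  set A : Set (EuclideanSpace ℝ (Fin N)) := {z | ‖z‖ ∈ Set.Ico ε ρ} with hA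
  have hAm : MeasurableSet A := measurable_norm measurableSet_Ico
  have hAε : A ⊆ (Metric.ball 0 ε)ᶜ := fun z hz => by simpa using hz.1
  have hAρ : A ⊆ Metric.ball 0 ρ := fun z hz => by simpa using hz.2
  have hpos : ∀ z ∈ A, 0 < ‖z‖ := fun z hz => hε.trans_le hz.1
  have h1 : IntegrableOn (fun z => inner ℝ b z * ‖z‖ ^ (-m)) A := by
    refine (((integrableOn_compl_ball_norm_rpow hN0 (e := 1 - m) (by linarith) hε).mono_set
      hAε).const_mul ‖b‖).mono' (by fun_prop : Measurable _).aestronglyMeasurable ?_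
    refine (ae_restrict_iff' hAm).2 (.of_forall fun z hz => ?_)
    rw [sub_eq_add_neg, Real.rpow_add (hpos z hz), Real.rpow_one, norm_mul, ← mul_assoc,
      Real.norm_of_nonneg (Real.rpow_nonneg (norm_nonneg z) _)]
    gcongr
    exact norm_inner_le_norm b z
  have h2 : IntegrableOn (fun z : EuclideanSpace ℝ (Fin N) => ‖z‖ ^ (2 - m)) (Metric.ball 0 ρ) :=
    integrableOn_ball_norm_rpow hN0 (by linarith) ρ
  have h2' := (h2.mono_set hAρ).const_mul D
  calc ∫ z in A, F z / ‖z‖ ^ m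
      ≤ ∫ z in A, (inner ℝ b z * ‖z‖ ^ (-m) + D * ‖z‖ ^ (2 - m)) := by
        refine setIntegral_mono_on hF (h1.add h2') hAm fun z hz => ?_
        have hz0 := hpos z hz
        have hk : 0 < ‖z‖ ^ m := Real.rpow_pos_of_pos hz0 _
        rw [Real.rpow_neg hz0.le, Real.rpow_sub hz0, div_le_iff₀ hk]
        have := hle z hz.2
        calc F z ≤ _ := this
          _ = _ := by
            field_simp
            norm_cast
    _ = D * ∫ z in A, ‖z‖ ^ (2 - m) := by
        rw [integral_add h1 h2', integral_const_mul,
          setIntegral_inner_mul_norm_eq_zero b (fun r => r ^ (-m)) (Set.Ico ε ρ), zero_add]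
    _ ≤ D * ∫ z in Metric.ball (0 : EuclideanSpace ℝ (Fin N)) ρ, ‖z‖ ^ (2 - m) := by
        refine mul_le_mul_of_nonneg_left ?_ hD
        refine setIntegral_mono_set h2 (.of_forall fun z => ?_) hAρ.eventuallyLE
        exact Real.rpow_nonneg (norm_nonneg _) _
    _ = _ := by
        rw [setIntegral_ball_norm_rpow hN0 (by linarith) hρ]
        congr 3 <;> [congr 1; skip] <;> rw [hm] <;> ring

theorem fracLaplacian_le_of_quadratic_touching {N : ℕ} (hN0 : 0 < N) {s C L : ℝ} (hs₁ : 1 / 2 < s)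
    (hs₂ : s < 1) (hC : 0 < C) {u : EuclideanSpace ℝ (Fin N) → ℝ} (hu : MemL2s N s u)
    {x b : EuclideanSpace ℝ (Fin N)} (hL : HasFracLaplacianAt N s C u x L) {A D ρ : ℝ}
    (hD : 0 ≤ D) (hρ : 0 < ρ)
    (hquad : ∀ z, ‖z‖ < ρ → u x - u (x + z) ≤ inner ℝ b z + D * ‖z‖ ^ 2)
    (hA : ∀ z, u x - u (x + z) ≤ A) :
    L ≤ C * (D * (unitSphereArea N * (ρ ^ (2 - 2 * s) / (2 - 2 * s))) +
      A * (unitSphereArea N * (ρ ^ (-(2 * s)) / (2 * s)))) := by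
  refine hL.le_of_eventually_le hC tendsto_const_nhds ?_
  filter_upwards [Ioo_mem_nhdsGT hρ] with ε hε
  set m : ℝ := (N : ℝ) + 2 * s with hm
  have hint := integrableOn_fracLaplacian_integrand hN0 (by linarith) hu hε.1 x
  rw [integrableOn_add_left_iff] at hint
  rw [setIntegral_add_left]
  simp only [sub_add_cancel_left, norm_neg] at hint ⊢
  have hset : (Metric.ball (0 : EuclideanSpace ℝ (Fin N)) ε)ᶜ =
      {z | ‖z‖ ∈ Set.Ico ε ρ} ∪ (Metric.ball 0 ρ)ᶜ := by
    ext z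
    simp only [Set.mem_compl_iff, Metric.mem_ball, dist_zero_right, not_lt, Set.mem_union,
      Set.mem_ofPred_eq, Set.mem_Ico]
    constructor
    · intro h
      rcases lt_or_ge ‖z‖ ρ with h' | h'
      · exact Or.inl ⟨h, h'⟩
      · exact Or.inr h'
    · rintro (h | h)
      · exact h.1
      · exact hε.2.le.trans h
  have hdisj : Disjoint {z : EuclideanSpace ℝ (Fin N) | ‖z‖ ∈ Set.Ico ε ρ} (Metric.ball 0 ρ)ᶜ := by
    rw [Set.disjoint_left]
    intro z hz h
    simp only [Set.mem_compl_iff, Metric.mem_ball, dist_zero_right] at h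
    exact h hz.2
  have hBm : MeasurableSet (Metric.ball (0 : EuclideanSpace ℝ (Fin N)) ρ)ᶜ :=
    Metric.isOpen_ball.measurableSet.compl
  rw [hset] at hint ⊢
  rw [setIntegral_union hdisj hBm hint.left_of_union hint.right_of_union]
  refine add_le_add (setIntegral_annulus_le hN0 hs₁ hs₂ hD hε.1 hρ hint.left_of_union hquad) ?_
  have h1 := integrableOn_compl_ball_norm_rpow hN0 (e := -m) (by rw [hm]; linarith) hρ
  calc ∫ z in (Metric.ball 0 ρ)ᶜ, (u x - u (x + z)) / ‖z‖ ^ m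
      ≤ ∫ z in (Metric.ball (0 : EuclideanSpace ℝ (Fin N)) ρ)ᶜ, A * ‖z‖ ^ (-m) := by
        refine setIntegral_mono_on hint.right_of_union (h1.const_mul A) hBm fun z _ => ?_
        rw [Real.rpow_neg (norm_nonneg _), div_eq_mul_inv]
        exact mul_le_mul_of_nonneg_right (hA z) (by positivity)
    _ = _ := by
        rw [integral_const_mul, setIntegral_compl_ball_norm_rpow hN0 (by rw [hm]; linarith) hρ]
        have h2 : (N : ℝ) + -m = -(2 * s) := by rw [hm]; ring
        rw [h2, neg_neg]

/-! ### The barrier |x|^(-θ) cut off near the origin. -/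

/-- Bernoulli's inequality is strict away from τ = 1, hence uniformly so on a compact interval. -/
theorem exists_convexity_gain {β τ₀ : ℝ} (hβ : 1 < β) (hτ₀ : τ₀ < 1) :
    ∃ c > 0, ∀ τ : ℝ, 0 ≤ τ → τ ≤ τ₀ → 1 - τ ^ β ≤ β * (1 - τ) - c := by
  have hcont : ContinuousOn (fun τ : ℝ => β * (1 - τ) - (1 - τ ^ β)) (Set.Icc 0 τ₀) := by
    refine ContinuousOn.sub (by fun_prop) (continuousOn_const.sub ?_)
    exact (Real.continuous_rpow_const (by linarith)).continuousOn
  obtain ⟨c, hc, h⟩ := isCompact_Icc.exists_forall_le' hcont (a := 0) fun τ hτ => by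
    have := one_add_mul_self_lt_rpow_one_add (s := τ - 1) (by linarith [hτ.1])
      (by linarith [hτ.2]) hβ
    rw [add_sub_cancel] at this
    linarith
  exact ⟨c, hc, fun τ h0 h1 => by linarith [h τ ⟨h0, h1⟩]⟩

/-- The function `|x|^(-θ)`, set to zero in the ball of radius `R₁`. -/
noncomputable def truncatedPower {N : ℕ} (θ R₁ : ℝ) (x : EuclideanSpace ℝ (Fin N)) : ℝ :=
  (Metric.ball (0 : EuclideanSpace ℝ (Fin N)) R₁)ᶜ.indicator (fun y => ‖y‖ ^ (-θ)) x

theorem truncatedPower_of_le {N : ℕ} {θ R₁ : ℝ} {x : EuclideanSpace ℝ (Fin N)} (h : R₁ ≤ ‖x‖) :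
    truncatedPower θ R₁ x = ‖x‖ ^ (-θ) :=
  Set.indicator_of_mem (by simpa using h) _

theorem truncatedPower_of_lt {N : ℕ} {θ R₁ : ℝ} {x : EuclideanSpace ℝ (Fin N)} (h : ‖x‖ < R₁) :
    truncatedPower θ R₁ x = 0 :=
  Set.indicator_of_notMem (by simpa using h) _

/-- The barrier is the power θ/a > 1 of the truncated |x|^(-a), so Bernoulli at the ratio τ of the
values at y and x linearizes it. The indicator on the inner ball corrects for the truncation; when
|x - y| ≥ 3|x|, so that |y| ≥ 2|x|, the ratio is at most 2^(-a) and convexity gains c₀. -/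
theorem truncatedPower_sub_le {N : ℕ} {a θ R₁ c₀ : ℝ} (ha : 0 < a) (hθ : a < θ) (hR₁ : 0 < R₁)
    (hc₀ : ∀ τ : ℝ, 0 ≤ τ → τ ≤ 2 ^ (-a) → 1 - τ ^ (θ / a) ≤ θ / a * (1 - τ) - c₀)
    {x : EuclideanSpace ℝ (Fin N)} (hx : R₁ ≤ ‖x‖) (y : EuclideanSpace ℝ (Fin N)) :
    truncatedPower θ R₁ x - truncatedPower θ R₁ y ≤
      θ / a * ‖x‖ ^ (a - θ) * (‖x‖ ^ (-a) - ‖y‖ ^ (-a) +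
        (Metric.ball (0 : EuclideanSpace ℝ (Fin N)) R₁).indicator (fun w => ‖w‖ ^ (-a)) y) -
      (Metric.ball x (3 * ‖x‖))ᶜ.indicator (fun _ => c₀ * ‖x‖ ^ (-θ)) y := by
  have hr : 0 < ‖x‖ := hR₁.trans_le hx
  have hβ : 1 < θ / a := (one_lt_div ha).2 hθ
  set T : ℝ := truncatedPower a R₁ y with hT
  have hT0 : 0 ≤ T := Set.indicator_nonneg (fun w _ => Real.rpow_nonneg (norm_nonneg w) _) y
  have hTv : -‖y‖ ^ (-a) + (Metric.ball (0 : EuclideanSpace ℝ (Fin N)) R₁).indicator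
      (fun w => ‖w‖ ^ (-a)) y = -T := by
    by_cases h : ‖y‖ < R₁
    · rw [hT, truncatedPower_of_lt h, Set.indicator_of_mem (by simpa using h)]; ring
    · rw [hT, truncatedPower_of_le (not_lt.1 h), Set.indicator_of_notMem (by simpa using h)]; ring
  have hψ : truncatedPower θ R₁ y = T ^ (θ / a) := by
    by_cases h : ‖y‖ < R₁
    · rw [hT, truncatedPower_of_lt h, truncatedPower_of_lt h, Real.zero_rpow (by linarith)]
    · rw [hT, truncatedPower_of_le (not_lt.1 h), truncatedPower_of_le (not_lt.1 h),
        ← Real.rpow_mul (norm_nonneg _)]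
      congr 1
      field_simp
  set τ : ℝ := T * ‖x‖ ^ a with hτ
  have hra : 0 < ‖x‖ ^ a := Real.rpow_pos_of_pos hr _
  have hrθ : 0 < ‖x‖ ^ (-θ) := Real.rpow_pos_of_pos hr _
  have hτ0 : 0 ≤ τ := by positivity
  have hTτ : T ^ (θ / a) = ‖x‖ ^ (-θ) * τ ^ (θ / a) := by
    rw [hτ, Real.mul_rpow hT0 hra.le, ← Real.rpow_mul hr.le, mul_div_cancel₀ _ ha.ne',
      mul_left_comm, ← Real.rpow_add hr, neg_add_cancel, Real.rpow_zero, mul_one]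
  have hlin : θ / a * ‖x‖ ^ (a - θ) * (‖x‖ ^ (-a) - T) = ‖x‖ ^ (-θ) * (θ / a * (1 - τ)) := by
    have h1 : ‖x‖ ^ (a - θ) = ‖x‖ ^ (-θ) * ‖x‖ ^ a := by
      rw [← Real.rpow_add hr]; ring_nf
    have h2 : ‖x‖ ^ a * ‖x‖ ^ (-a) = 1 := by
      rw [← Real.rpow_add hr, add_neg_cancel, Real.rpow_zero]
    rw [h1, hτ]
    linear_combination (θ / a * ‖x‖ ^ (-θ)) * h2
  have hB : 1 - τ ^ (θ / a) ≤ θ / a * (1 - τ) := by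
    have := one_add_mul_self_le_rpow_one_add (s := τ - 1) (by linarith) hβ.le
    rw [add_sub_cancel] at this
    linarith
  have hcomb : ‖x‖ ^ (-a) - ‖y‖ ^ (-a) + (Metric.ball (0 : EuclideanSpace ℝ (Fin N)) R₁).indicator
      (fun w => ‖w‖ ^ (-a)) y = ‖x‖ ^ (-a) - T := by linarith
  rw [hcomb, hlin, hψ, hTτ, truncatedPower_of_le hx]
  by_cases hfar : 3 * ‖x‖ ≤ ‖x - y‖
  · rw [Set.indicator_of_mem (by simpa [dist_eq_norm, norm_sub_rev] using hfar)]
    have hy : 2 * ‖x‖ ≤ ‖y‖ := by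
      have := norm_sub_le x y
      linarith
    have hτ2 : τ ≤ 2 ^ (-a) := by
      rw [hτ, hT, truncatedPower_of_le (by linarith)]
      calc ‖y‖ ^ (-a) * ‖x‖ ^ a ≤ (2 * ‖x‖) ^ (-a) * ‖x‖ ^ a := by
            refine mul_le_mul_of_nonneg_right ?_ hra.le
            exact Real.rpow_le_rpow_of_nonpos (by positivity) hy (by linarith)
        _ = 2 ^ (-a) := by
            rw [Real.mul_rpow two_pos.le hr.le, mul_assoc, ← Real.rpow_add hr, neg_add_cancel,
              Real.rpow_zero, mul_one]
    have := mul_le_mul_of_nonneg_left (hc₀ τ hτ0 hτ2) hrθ.le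
    linarith
  · rw [Set.indicator_of_notMem (by simpa [dist_eq_norm, norm_sub_rev] using hfar)]
    have := mul_le_mul_of_nonneg_left hB hrθ.le
    linarith

theorem setIntegral_ball_riesz_kernel_le {N : ℕ} (hN0 : 0 < N) {s : ℝ} (hs : 0 < s)
    (hN : 2 * s < (N : ℝ)) {R₁ : ℝ} (hR₁ : 0 < R₁) {x : EuclideanSpace ℝ (Fin N)}
    (hx : 2 * R₁ ≤ ‖x‖) :
    IntegrableOn (fun y => ‖y‖ ^ (-((N : ℝ) - 2 * s)) / ‖x - y‖ ^ ((N : ℝ) + 2 * s))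
      (Metric.ball 0 R₁) ∧
    ∫ y in Metric.ball (0 : EuclideanSpace ℝ (Fin N)) R₁,
      ‖y‖ ^ (-((N : ℝ) - 2 * s)) / ‖x - y‖ ^ ((N : ℝ) + 2 * s) ≤
      (‖x‖ / 2) ^ (-((N : ℝ) + 2 * s)) * (unitSphereArea N * (R₁ ^ (2 * s) / (2 * s))) := by
  set a : ℝ := (N : ℝ) - 2 * s with ha
  set m : ℝ := (N : ℝ) + 2 * s with hm
  have hm0 : 0 < m := by positivity
  have hr : 0 < ‖x‖ := by linarith
  have hbound : ∀ y ∈ Metric.ball (0 : EuclideanSpace ℝ (Fin N)) R₁,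
      ‖y‖ ^ (-a) / ‖x - y‖ ^ m ≤ (‖x‖ / 2) ^ (-m) * ‖y‖ ^ (-a) := by
    intro y hy
    have hy' : ‖y‖ < R₁ := by simpa using hy
    have h1 := norm_sub_norm_le x y
    have h2 : ‖x‖ / 2 ≤ ‖x - y‖ := by linarith
    rw [div_eq_mul_inv, mul_comm, ← Real.rpow_neg (norm_nonneg _)]
    exact mul_le_mul_of_nonneg_right
      (Real.rpow_le_rpow_of_nonpos (by positivity) h2 (by linarith)) (by positivity)
  have h1 := (integrableOn_ball_norm_rpow hN0 (e := -a) (by rw [ha]; linarith) R₁).const_mul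
    ((‖x‖ / 2) ^ (-m))
  have hint : IntegrableOn (fun y => ‖y‖ ^ (-a) / ‖x - y‖ ^ m) (Metric.ball 0 R₁) := by
    refine h1.mono' (by fun_prop : Measurable _).aestronglyMeasurable ?_
    refine (ae_restrict_iff' Metric.isOpen_ball.measurableSet).2 (.of_forall fun y hy => ?_)
    rw [Real.norm_of_nonneg (by positivity)]
    exact hbound y hy
  refine ⟨hint, (setIntegral_mono_on hint h1 Metric.isOpen_ball.measurableSet hbound).trans ?_⟩
  rw [integral_const_mul, setIntegral_ball_norm_rpow hN0 (by rw [ha]; linarith) hR₁]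
  have : (N : ℝ) + -a = 2 * s := by rw [ha]; ring
  rw [this]

theorem setIntegral_le_of_touching_truncatedPower {N : ℕ} (hN0 : 0 < N) {s : ℝ} (hs : 0 < s)
    (hN : 2 * s < (N : ℝ)) {θ R₁ c₀ κ ε K : ℝ} (hθ : (N : ℝ) - 2 * s < θ) (hR₁ : 0 < R₁)
    (hc₀ : ∀ τ : ℝ, 0 ≤ τ → τ ≤ 2 ^ (-((N : ℝ) - 2 * s)) →
      1 - τ ^ (θ / ((N : ℝ) - 2 * s)) ≤ θ / ((N : ℝ) - 2 * s) * (1 - τ) - c₀)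
    (hκ : 0 ≤ κ) {u : EuclideanSpace ℝ (Fin N) → ℝ} (hu : MemL2s N s u)
    {x : EuclideanSpace ℝ (Fin N)} (hx : 2 * R₁ ≤ ‖x‖)
    (htouch : ∀ y, u x - u y ≤ κ * (truncatedPower θ R₁ x - truncatedPower θ R₁ y))
    (hε : 0 < ε) (hεr : ε ≤ ‖x‖ / 3)
    (hK : ∫ y in (Metric.ball x ε)ᶜ, (‖x‖ ^ (-((N : ℝ) - 2 * s)) - ‖y‖ ^ (-((N : ℝ) - 2 * s))) /
        ‖x - y‖ ^ ((N : ℝ) + 2 * s) ≤ K) :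
    ∫ y in (Metric.ball x ε)ᶜ, (u x - u y) / ‖x - y‖ ^ ((N : ℝ) + 2 * s) ≤
      κ * (θ / ((N : ℝ) - 2 * s) * ‖x‖ ^ ((N : ℝ) - 2 * s - θ) * (K +
        (‖x‖ / 2) ^ (-((N : ℝ) + 2 * s)) * (unitSphereArea N * (R₁ ^ (2 * s) / (2 * s)))) -
        c₀ * ‖x‖ ^ (-θ) * (unitSphereArea N * ((3 * ‖x‖) ^ (-(2 * s)) / (2 * s)))) := by
  set a : ℝ := (N : ℝ) - 2 * s with ha
  set m : ℝ := (N : ℝ) + 2 * s with hm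
  have ha0 : 0 < a := by rw [ha]; linarith
  have hr : 0 < ‖x‖ := by linarith
  set S : Set (EuclideanSpace ℝ (Fin N)) := (Metric.ball x ε)ᶜ with hS
  set B : Set (EuclideanSpace ℝ (Fin N)) := Metric.ball 0 R₁ with hB
  set Z : Set (EuclideanSpace ℝ (Fin N)) := (Metric.ball x (3 * ‖x‖))ᶜ with hZ
  have hSm : MeasurableSet S := Metric.isOpen_ball.measurableSet.compl
  have hBm : MeasurableSet B := Metric.isOpen_ball.measurableSet
  have hZm : MeasurableSet Z := Metric.isOpen_ball.measurableSet.compl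
  have hZS : Z ⊆ S := Set.compl_subset_compl.2 (Metric.ball_subset_ball (by linarith))
  have hBS : B ⊆ S := by
    intro y hy
    have hy' : ‖y‖ < R₁ := by simpa [hB] using hy
    have := norm_sub_norm_le x y
    have h3 : ε ≤ ‖x - y‖ := by linarith
    simpa [hS, dist_eq_norm, norm_sub_rev] using h3
  obtain ⟨hBi, hBv⟩ := setIntegral_ball_riesz_kernel_le hN0 hs hN hR₁ hx
  have hGi := integrableOn_riesz_integrand hN0 hs hN hε x
  rw [← ha, ← hm, ← hS] at hGi
  rw [← ha, ← hm, ← hB] at hBi hBv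
  have hZi := integrableOn_compl_ball_inv_norm_sub_rpow hN0 (m := m) (by rw [hm]; linarith)
    (by positivity : 0 < 3 * ‖x‖) x
  have hZv : ∫ y in Z, 1 / ‖x - y‖ ^ m =
      unitSphereArea N * ((3 * ‖x‖) ^ (-(2 * s)) / (2 * s)) := by
    rw [hZ, setIntegral_add_left]
    have h1 := setIntegral_compl_ball_norm_rpow hN0 (e := -m) (by rw [hm]; linarith)
      (by positivity : 0 < 3 * ‖x‖)
    have h2 : (N : ℝ) + -m = -(2 * s) := by rw [hm]; ring
    rw [h2, neg_neg] at h1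
    rw [← h1]
    congr 1
    ext z
    rw [sub_add_cancel_left, norm_neg, one_div, Real.rpow_neg (norm_nonneg _)]
  have hBi' : IntegrableOn (B.indicator fun y => ‖y‖ ^ (-a) / ‖x - y‖ ^ m) S :=
    ((integrable_indicator_iff hBm).2 hBi).integrableOn
  have hZi' : IntegrableOn (Z.indicator fun y => 1 / ‖x - y‖ ^ m) S :=
    ((integrable_indicator_iff hZm).2 hZi).integrableOn
  set β : ℝ := θ / a * ‖x‖ ^ (a - θ) with hβ
  have hβ0 : 0 ≤ β := by
    have : 0 < θ := ha0.trans hθ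
    positivity
  have hsum := ((hGi.add hBi').const_mul β).sub (hZi'.const_mul (c₀ * ‖x‖ ^ (-θ)))
  calc ∫ y in S, (u x - u y) / ‖x - y‖ ^ m
      ≤ ∫ y in S, κ * (β * ((‖x‖ ^ (-a) - ‖y‖ ^ (-a)) / ‖x - y‖ ^ m +
          B.indicator (fun y => ‖y‖ ^ (-a) / ‖x - y‖ ^ m) y) -
          c₀ * ‖x‖ ^ (-θ) * Z.indicator (fun y => 1 / ‖x - y‖ ^ m) y) := by
        refine setIntegral_mono_on (integrableOn_fracLaplacian_integrand hN0 hs hu hε x)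
          (hsum.const_mul κ) hSm fun y _ => ?_
        have h1 := (htouch y).trans (mul_le_mul_of_nonneg_left
          (truncatedPower_sub_le ha0 hθ hR₁ hc₀ (by linarith : R₁ ≤ ‖x‖) y) hκ)
        rw [← hB, ← hZ, ← hβ] at h1
        have h2 : 0 ≤ ‖x - y‖ ^ m := Real.rpow_nonneg (norm_nonneg _) _
        refine (div_le_div_of_nonneg_right h1 h2).trans_eq ?_
        by_cases hyB : y ∈ B <;> by_cases hyZ : y ∈ Z <;>
          simp only [hyB, hyZ, Set.indicator_of_mem, Set.indicator_of_notMem, not_false_eq_true] <;>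
          ring
    _ = κ * (β * ((∫ y in S, (‖x‖ ^ (-a) - ‖y‖ ^ (-a)) / ‖x - y‖ ^ m) +
          ∫ y in B, ‖y‖ ^ (-a) / ‖x - y‖ ^ m) - c₀ * ‖x‖ ^ (-θ) * ∫ y in Z, 1 / ‖x - y‖ ^ m) := by
        rw [integral_const_mul, integral_sub (f := fun y => β * ((‖x‖ ^ (-a) - ‖y‖ ^ (-a)) / ‖x - y‖ ^ m +
            B.indicator (fun y => ‖y‖ ^ (-a) / ‖x - y‖ ^ m) y)) ((hGi.add hBi').const_mul β)
          (hZi'.const_mul (c₀ * ‖x‖ ^ (-θ))), integral_const_mul, integral_const_mul,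
          integral_add hGi hBi', setIntegral_indicator hBm, setIntegral_indicator hZm,
          Set.inter_eq_right.2 hBS, Set.inter_eq_right.2 hZS]
    _ ≤ _ := by
        rw [hZv]
        gcongr

/-- After integration the convexity gain is of order |x|^(-θ-2s) and the truncation error of order
|x|^(-θ-4s), while the Riesz term vanishes as ε → 0. Both c and `R₂` are independent of u and κ. -/
theorem fracLaplacian_le_of_touching_truncatedPower {N : ℕ} (hN0 : 0 < N) {s C θ R₁ : ℝ}
    (hs₁ : 1 / 2 < s) (hs₂ : s < 1) (hN : 2 * s < (N : ℝ)) (hC : 0 < C)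
    (hθ : (N : ℝ) - 2 * s < θ) (hR₁ : 0 < R₁) :
    ∃ c > 0, ∃ R₂ ≥ 2 * R₁, ∀ u : EuclideanSpace ℝ (Fin N) → ℝ, MemL2s N s u → ∀ x, R₂ ≤ ‖x‖ →
      ∀ κ ≥ 0, ∀ L, HasFracLaplacianAt N s C u x L →
      (∀ y, u x - u y ≤ κ * (truncatedPower θ R₁ x - truncatedPower θ R₁ y)) →
      L ≤ -(c * κ * ‖x‖ ^ (-θ - 2 * s)) := by
  set a : ℝ := (N : ℝ) - 2 * s with ha
  set m : ℝ := (N : ℝ) + 2 * s with hm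
  have ha0 : 0 < a := by rw [ha]; linarith
  have hθ0 : 0 < θ := ha0.trans hθ
  have hA := unitSphereArea_pos hN0
  obtain ⟨c₀, hc₀, hgain⟩ := exists_convexity_gain ((one_lt_div ha0).2 hθ)
    (Real.rpow_lt_one_of_one_lt_of_neg one_lt_two (by linarith) : (2 : ℝ) ^ (-a) < 1)
  set c₁ : ℝ := c₀ * (unitSphereArea N * (3 ^ (-(2 * s)) / (2 * s))) with hc₁
  set C₂ : ℝ := θ / a * (2 ^ m * (unitSphereArea N * (R₁ ^ (2 * s) / (2 * s)))) with hC₂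
  have hc₁0 : 0 < c₁ := by positivity
  have htend : Tendsto (fun r : ℝ => C₂ * r ^ (-(2 * s))) atTop (𝓝 (C₂ * 0)) :=
    (tendsto_rpow_neg_atTop (by linarith)).const_mul C₂
  rw [mul_zero] at htend
  -- Beyond `R₂` the truncation error consumes at most half of the gain.
  obtain ⟨R₂, hR₂⟩ := eventually_atTop.1 (htend.eventually (ge_mem_nhds (half_pos hc₁0)))
  refine ⟨C * (c₁ / 2), by positivity, max R₂ (2 * R₁), le_max_right _ _, ?_⟩
  intro u hu x hx κ hκ L hL htouch
  have hx1 : 2 * R₁ ≤ ‖x‖ := (le_max_right _ _).trans hx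
  have hr : 0 < ‖x‖ := by linarith
  have hx0 : x ≠ 0 := norm_pos_iff.1 hr
  have hsmall := hR₂ ‖x‖ ((le_max_left _ _).trans hx)
  obtain ⟨K, hK⟩ := setIntegral_riesz_integrand_le hN0 hs₁ hs₂ hN hx0
  have hKt : Tendsto (fun ε : ℝ => K * ε ^ (2 - 2 * s)) (𝓝[>] 0) (𝓝 0) := by
    have h1 : Tendsto (fun ε : ℝ => K * ε ^ (2 - 2 * s)) (𝓝 0) (𝓝 (K * 0 ^ (2 - 2 * s))) :=
      ((Real.continuous_rpow_const (by linarith)).const_mul K).tendsto 0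
    rw [Real.zero_rpow (by linarith), mul_zero] at h1
    exact h1.mono_left nhdsWithin_le_nhds
  have hlim := (((hKt.add_const ((‖x‖ / 2) ^ (-m) * (unitSphereArea N *
    (R₁ ^ (2 * s) / (2 * s))))).const_mul (θ / a * ‖x‖ ^ (a - θ))).sub_const
      (c₀ * ‖x‖ ^ (-θ) * (unitSphereArea N * ((3 * ‖x‖) ^ (-(2 * s)) / (2 * s))))).const_mul κ
  have hle := hL.le_of_eventually_le hC hlim (by
    filter_upwards [Ioc_mem_nhdsGT (by positivity : 0 < ‖x‖ / 3)] with ε hε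
    exact setIntegral_le_of_touching_truncatedPower hN0 (by linarith) hN hθ hR₁ hgain hκ hu hx1
      htouch hε.1 hε.2 (hK ε hε.1 hε.2))
  refine hle.trans ?_
  have e1 : ‖x‖ ^ (a - θ) * (‖x‖ / 2) ^ (-m) =
      2 ^ m * ‖x‖ ^ (-(2 * s)) * ‖x‖ ^ (-θ - 2 * s) := by
    rw [Real.div_rpow hr.le two_pos.le, Real.rpow_neg two_pos.le, div_inv_eq_mul, ← mul_assoc,
      ← Real.rpow_add hr, mul_assoc, ← Real.rpow_add hr, mul_comm]
    congr 2
    rw [ha, hm]; ring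
  have e2 : ‖x‖ ^ (-θ) * (3 * ‖x‖) ^ (-(2 * s)) = 3 ^ (-(2 * s)) * ‖x‖ ^ (-θ - 2 * s) := by
    rw [Real.mul_rpow (by norm_num) hr.le, mul_left_comm, ← Real.rpow_add hr, ← sub_eq_add_neg]
  have e3 : θ / a * ‖x‖ ^ (a - θ) * (0 + (‖x‖ / 2) ^ (-m) *
      (unitSphereArea N * (R₁ ^ (2 * s) / (2 * s)))) -
      c₀ * ‖x‖ ^ (-θ) * (unitSphereArea N * ((3 * ‖x‖) ^ (-(2 * s)) / (2 * s))) =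
      (C₂ * ‖x‖ ^ (-(2 * s)) - c₁) * ‖x‖ ^ (-θ - 2 * s) := by
    rw [hC₂, hc₁]
    linear_combination (θ / a * (unitSphereArea N * (R₁ ^ (2 * s) / (2 * s)))) * e1 -
      (c₀ * unitSphereArea N / (2 * s)) * e2
  rw [e3]
  have hp : 0 ≤ ‖x‖ ^ (-θ - 2 * s) := by positivity
  calc C * (κ * ((C₂ * ‖x‖ ^ (-(2 * s)) - c₁) * ‖x‖ ^ (-θ - 2 * s)))
      ≤ C * (κ * (-(c₁ / 2) * ‖x‖ ^ (-θ - 2 * s))) := by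
        gcongr
        linarith
    _ = _ := by ring

/-! ### The lower bound for u. -/

theorem IsClassicalSupersolution.continuousOn {N : ℕ} {s C q lam R₀ : ℝ} {f : ℝ → ℝ}
    {u : EuclideanSpace ℝ (Fin N) → ℝ} (h : IsClassicalSupersolution N s C q lam R₀ f u)
    {S : Set (EuclideanSpace ℝ (Fin N))} (hS : ∀ x ∈ S, R₀ < ‖x‖) : ContinuousOn u S :=
  h.contDiffOn.continuousOn.mono fun x hx => by simpa using hS x hx

theorem IsClassicalSupersolution.differentiableAt {N : ℕ} {s C q lam R₀ : ℝ} {f : ℝ → ℝ}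
    {u : EuclideanSpace ℝ (Fin N) → ℝ} (h : IsClassicalSupersolution N s C q lam R₀ f u)
    {x : EuclideanSpace ℝ (Fin N)} (hx : R₀ < ‖x‖) : DifferentiableAt ℝ u x :=
  (h.contDiffOn.contDiffAt (Metric.isClosed_closedBall.isOpen_compl.mem_nhds
    (by simpa using hx))).differentiableAt (by norm_num)

theorem IsClassicalSupersolution.lower_bound {N : ℕ} (hN0 : 0 < N) {s C q lam R₀ θ : ℝ}
    (hs₁ : 1 / 2 < s) (hs₂ : s < 1) (hN : 2 * s < (N : ℝ)) (hC : 0 < C) (hlam : 0 < lam)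
    (hR₀ : 0 < R₀) (hq : 1 < q) (hθ : (N : ℝ) - 2 * s < θ) (hθq : θ + 2 * s ≤ q * (θ + 1))
    {f : ℝ → ℝ} (hf : ∀ t, 0 < t → 0 < f t)
    {u : EuclideanSpace ℝ (Fin N) → ℝ} (h : IsClassicalSupersolution N s C q lam R₀ f u)
    (hu : ∀ x, 0 < u x) :
    ∃ κ > 0, ∃ R₂, ∀ x, R₂ ≤ ‖x‖ → κ * ‖x‖ ^ (-θ) ≤ u x := by
  have hθ0 : 0 < θ := by linarith
  set R₁ : ℝ := R₀ + 1 with hR₁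
  have hR₁0 : 0 < R₁ := by positivity
  obtain ⟨c, hc, R₂, hR₂, hfrac⟩ :=
    fracLaplacian_le_of_touching_truncatedPower hN0 (R₁ := R₁) hs₁ hs₂ hN hC hθ hR₁0
  have hcompact : ∀ A B : ℝ, IsCompact {x : EuclideanSpace ℝ (Fin N) | A ≤ ‖x‖ ∧ ‖x‖ ≤ B} := by
    intro A B
    refine (isCompact_closedBall (0 : EuclideanSpace ℝ (Fin N)) B).of_isClosed_subset ?_ ?_
    · exact (isClosed_le continuous_const continuous_norm).inter
        (isClosed_le continuous_norm continuous_const)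
    · intro x hx
      simpa using hx.2
  obtain ⟨μ, hμ, hμu⟩ := (hcompact R₁ R₂).exists_forall_le' (a := 0)
    (h.continuousOn fun x hx => by linarith [hx.1]) (fun x _ => hu x)
  have hθp : 0 < θ ^ q := Real.rpow_pos_of_pos hθ0 _
  set κ₁ : ℝ := (c / θ ^ q) ^ (1 / (q - 1)) with hκ₁
  have hκ₁0 : 0 < κ₁ := by positivity
  -- The first entry keeps the barrier below u up to radius `R₂`; the second, since q > 1, lets the
  -- gradient term be absorbed.
  set κ : ℝ := min (μ * R₁ ^ θ) κ₁ with hκ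
  have hκ0 : 0 < κ := lt_min (by positivity) hκ₁0
  have hκgrad : κ ^ q * θ ^ q ≤ c * κ := by
    have h1 : κ ^ (q - 1) ≤ c / θ ^ q := by
      calc κ ^ (q - 1) ≤ κ₁ ^ (q - 1) :=
            Real.rpow_le_rpow hκ0.le (min_le_right _ _) (by linarith)
        _ = c / θ ^ q := by
            have : q - 1 ≠ 0 := by linarith
            rw [hκ₁, ← Real.rpow_mul (by positivity), one_div_mul_cancel this, Real.rpow_one]
    rw [le_div_iff₀ hθp] at h1
    have h2 : κ ^ q = κ ^ (q - 1) * κ := by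
      rw [Real.rpow_sub_one hκ0.ne']; field_simp
    rw [h2]
    nlinarith
  have hψ0 : ∀ y : EuclideanSpace ℝ (Fin N), 0 ≤ truncatedPower θ R₁ y := fun y =>
    Set.indicator_nonneg (fun w _ => Real.rpow_nonneg (norm_nonneg w) _) y
  have hinner : ∀ y : EuclideanSpace ℝ (Fin N), ‖y‖ ≤ R₂ → κ * truncatedPower θ R₁ y ≤ u y := by
    intro y hy
    rcases lt_or_ge ‖y‖ R₁ with hlt | hge
    · rw [truncatedPower_of_lt hlt, mul_zero]
      exact (hu y).le
    · rw [truncatedPower_of_le hge]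
      refine le_trans ?_ (hμu y ⟨hge, hy⟩)
      calc κ * ‖y‖ ^ (-θ) ≤ (μ * R₁ ^ θ) * R₁ ^ (-θ) := by
            refine mul_le_mul (min_le_left _ _)
              (Real.rpow_le_rpow_of_nonpos hR₁0 hge (by linarith)) (by positivity) (by positivity)
        _ = μ := by
            rw [mul_assoc, ← Real.rpow_add hR₁0, add_neg_cancel, Real.rpow_zero, mul_one]
  refine ⟨κ, hκ0, R₂, fun x₁ hx₁ => ?_⟩
  by_contra! hneg
  set d : ℝ := κ * ‖x₁‖ ^ (-θ) - u x₁ with hd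
  have hd0 : 0 < d := by linarith
  have hdecay : Tendsto (fun r : ℝ => κ * r ^ (-θ)) atTop (𝓝 (κ * 0)) :=
    (tendsto_rpow_neg_atTop hθ0).const_mul κ
  rw [mul_zero] at hdecay
  -- Beyond `R₃` the barrier is at most d and u > 0, so u minus the barrier exceeds -d there. A
  -- minimum on the annulus is at most -d, hence global.
  obtain ⟨R₃, hR₃⟩ := eventually_atTop.1 (hdecay.eventually (ge_mem_nhds hd0))
  have hx₁R₁ : R₁ ≤ ‖x₁‖ := by linarith
  have hcont : ContinuousOn (fun y => u y - κ * ‖y‖ ^ (-θ))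
      {y | R₂ ≤ ‖y‖ ∧ ‖y‖ ≤ max R₃ ‖x₁‖} := by
    refine (h.continuousOn fun x hx => by linarith [hx.1]).sub (continuousOn_const.mul ?_)
    exact continuous_norm.continuousOn.rpow_const fun y hy => Or.inl (by linarith [hy.1])
  obtain ⟨x, hxmem, hxmin⟩ := (hcompact R₂ (max R₃ ‖x₁‖)).exists_isMinOn
    ⟨x₁, hx₁, le_max_right _ _⟩ hcont
  have hxle : u x - κ * ‖x‖ ^ (-θ) ≤ -d := by
    have h1 := hxmin (a := x₁) ⟨hx₁, le_max_right _ _⟩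
    simp only [Set.mem_ofPred_eq] at h1
    linarith
  have hxR₁ : R₁ ≤ ‖x‖ := by linarith [hxmem.1]
  have hψx : truncatedPower θ R₁ x = ‖x‖ ^ (-θ) := truncatedPower_of_le hxR₁
  have htouch : ∀ y, u x - u y ≤ κ * (truncatedPower θ R₁ x - truncatedPower θ R₁ y) := by
    intro y
    rw [hψx, mul_sub]
    rcases le_or_gt ‖y‖ R₂ with hy | hy
    · linarith [hinner y hy]
    · have hψy : truncatedPower θ R₁ y = ‖y‖ ^ (-θ) := truncatedPower_of_le (by linarith)
      rw [hψy]
      rcases le_or_gt ‖y‖ (max R₃ ‖x₁‖) with hy' | hy'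
      · have h1 := hxmin (a := y) ⟨hy.le, hy'⟩
        simp only [Set.mem_ofPred_eq] at h1
        linarith
      · have h1 := hR₃ ‖y‖ ((le_max_left _ _).trans hy'.le)
        linarith [hu y]
  have hr : 0 < ‖x‖ := by linarith
  obtain ⟨L, hL, hle⟩ := h.le x (by simpa using (by linarith : R₀ < ‖x‖))
  have hL' := hfrac u h.memL2s x hxmem.1 κ hκ0.le L hL htouch
  have hgrad : ‖gradient u x‖ ≤ κ * (θ * ‖x‖ ^ (-θ - 1)) := by
    refine norm_gradient_le_of_eventually_sub_le (h.differentiableAt (by linarith))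
      (by positivity) ?_
    have hopen : ∀ᶠ y : EuclideanSpace ℝ (Fin N) in 𝓝 x, R₁ < ‖y‖ :=
      continuous_norm.continuousAt.eventually (lt_mem_nhds (by linarith [hxmem.1]))
    filter_upwards [hopen] with y hy
    refine (htouch y).trans ?_
    rw [hψx, truncatedPower_of_le hy.le, mul_assoc]
    refine mul_le_mul_of_nonneg_left ?_ hκ0.le
    refine (rpow_neg_tangent_le hθ0.le hr (by linarith)).trans ?_
    refine mul_le_mul_of_nonneg_left ?_ (by positivity)
    rw [norm_sub_rev]
    exact norm_sub_norm_le y x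
  have hx1 : 1 ≤ ‖x‖ := by linarith
  have hgradq : ‖gradient u x‖ ^ q ≤ c * κ * ‖x‖ ^ (-θ - 2 * s) := by
    calc ‖gradient u x‖ ^ q ≤ (κ * (θ * ‖x‖ ^ (-θ - 1))) ^ q :=
          Real.rpow_le_rpow (norm_nonneg _) hgrad (by linarith)
      _ = κ ^ q * θ ^ q * ‖x‖ ^ ((-θ - 1) * q) := by
          rw [Real.mul_rpow hκ0.le (by positivity), Real.mul_rpow hθ0.le (by positivity),
            ← Real.rpow_mul hr.le, mul_assoc]
      _ ≤ c * κ * ‖x‖ ^ (-θ - 2 * s) := by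
          refine mul_le_mul hκgrad (Real.rpow_le_rpow_of_exponent_le hx1 ?_) (by positivity)
            (by positivity)
          linarith
  have hfpos : 0 < lam * f (u x) := mul_pos hlam (hf _ (hu x))
  linarith

/-! ### Improvement of decay along sequences. -/

/-- The lower limit controls f near 0, and positivity with compactness controls it on [δ, M]. -/
theorem exists_rpow_le_of_liminf_pos {f : ℝ → ℝ} {p : ℝ} (hf_cont : ContinuousOn f (Set.Ioi 0))
    (hf_pos : ∀ t : ℝ, 0 < t → 0 < f t)
    (hf_liminf : 0 < liminf (fun t : ℝ => ((f t / t ^ p : ℝ) : EReal)) (𝓝[>] (0 : ℝ)))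
    (M : ℝ) : ∃ c > 0, ∀ t, 0 < t → t ≤ M → c * t ^ p ≤ f t := by
  obtain ⟨b, hb0, hb⟩ := EReal.lt_iff_exists_real_btwn.1 hf_liminf
  have hb0' : 0 < b := by exact_mod_cast hb0
  have hev := eventually_lt_of_lt_liminf hb
  obtain ⟨δ, hδ, hδb⟩ := mem_nhdsGT_iff_exists_Ioo_subset.1 hev
  have hδ0 : 0 < δ := hδ
  have hcont : ContinuousOn (fun t : ℝ => f t / t ^ p) (Set.Icc δ M) := by
    refine (hf_cont.mono fun t ht => hδ0.trans_le ht.1).div ?_ ?_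
    · exact continuousOn_id.rpow_const fun t ht => Or.inl (hδ0.trans_le ht.1).ne'
    · exact fun t ht => (Real.rpow_pos_of_pos (hδ0.trans_le ht.1) _).ne'
  obtain ⟨e, he, heM⟩ := isCompact_Icc.exists_forall_le' hcont (a := 0) fun t ht =>
    div_pos (hf_pos t (hδ0.trans_le ht.1)) (Real.rpow_pos_of_pos (hδ0.trans_le ht.1) _)
  refine ⟨min b e, lt_min hb0' he, fun t ht htM => ?_⟩
  rw [← le_div_iff₀ (Real.rpow_pos_of_pos ht _)]
  rcases lt_or_ge t δ with h | h
  · have h1 : (b : EReal) < ((f t / t ^ p : ℝ) : EReal) := hδb ⟨ht, h⟩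
    exact (min_le_left _ _).trans (by exact_mod_cast h1.le)
  · exact (min_le_right _ _).trans (heM t ⟨h, htM⟩)

/-- `u(x) ≤ K |x|^(-α)` at points `x` of arbitrarily large norm. -/
def FrequentlyDecays {N : ℕ} (u : EuclideanSpace ℝ (Fin N) → ℝ) (α : ℝ) : Prop :=
  ∃ K : ℝ, ∀ R : ℝ, ∃ x, R ≤ ‖x‖ ∧ u x ≤ K * ‖x‖ ^ (-α)

theorem frequentlyDecays_zero_of_not_blowsUp {N : ℕ} {u : EuclideanSpace ℝ (Fin N) → ℝ}
    (h : ¬ BlowsUpAtInfinity u) : FrequentlyDecays u 0 := by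
  unfold BlowsUpAtInfinity at h
  rw [tendsto_atTop] at h
  push Not at h
  obtain ⟨K, hK⟩ := h
  refine ⟨K, fun R => ?_⟩
  have h1 : ∀ᶠ x in cocompact (EuclideanSpace ℝ (Fin N)), R ≤ ‖x‖ :=
    (tendsto_norm_cocompact_atTop (E := EuclideanSpace ℝ (Fin N))).eventually_ge_atTop R
  obtain ⟨x, hx, hR⟩ := (hK.and_eventually h1).exists
  refine ⟨x, hR, ?_⟩
  rw [neg_zero, Real.rpow_zero, mul_one]
  exact hx.le

theorem not_frequentlyDecays_of_lower_bound {N : ℕ} {u : EuclideanSpace ℝ (Fin N) → ℝ}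
    {κ θ R₂ α : ℝ} (hκ : 0 < κ) (h : ∀ x, R₂ ≤ ‖x‖ → κ * ‖x‖ ^ (-θ) ≤ u x) (hα : θ < α) :
    ¬ FrequentlyDecays u α := by
  rintro ⟨K, hK⟩
  have htend : Tendsto (fun r : ℝ => K * r ^ (-(α - θ))) atTop (𝓝 (K * 0)) :=
    (tendsto_rpow_neg_atTop (by linarith)).const_mul K
  rw [mul_zero] at htend
  obtain ⟨R₃, hR₃⟩ := eventually_atTop.1 (htend.eventually (gt_mem_nhds hκ))
  obtain ⟨x, hx, hux⟩ := hK (max (max R₂ R₃) 1)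
  have hr : 0 < ‖x‖ := one_pos.trans_le ((le_max_right _ _).trans hx)
  have h1 := h x (((le_max_left _ _).trans (le_max_left _ _)).trans hx)
  have h2 := hR₃ ‖x‖ (((le_max_right _ _).trans (le_max_left _ _)).trans hx)
  have h3 : K * ‖x‖ ^ (-α) = K * ‖x‖ ^ (-(α - θ)) * ‖x‖ ^ (-θ) := by
    rw [mul_assoc, ← Real.rpow_add hr]; ring_nf
  have h4 : 0 < ‖x‖ ^ (-θ) := Real.rpow_pos_of_pos hr _
  nlinarith

/-- A paraboloid centred at x₀ is added to u and the sum minimized; positivity of u makes the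
interior minimum global. -/
theorem IsClassicalSupersolution.exists_touching_point {N : ℕ} (hN0 : 0 < N)
    {s C q lam R₀ : ℝ} (hs₁ : 1 / 2 < s) (hs₂ : s < 1) (hC : 0 < C) (hR₀ : 0 < R₀) (hq : 0 < q)
    {f : ℝ → ℝ} {u : EuclideanSpace ℝ (Fin N) → ℝ}
    (h : IsClassicalSupersolution N s C q lam R₀ f u) (hu : ∀ x, 0 < u x)
    {x₀ : EuclideanSpace ℝ (Fin N)} (hx₀ : 2 * R₀ < ‖x₀‖) {A : ℝ} (hA : u x₀ < A) :
    ∃ x, ‖x - x₀‖ < ‖x₀‖ / 2 ∧ u x ≤ A ∧ lam * f (u x) ≤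
      C * unitSphereArea N * (4 / (2 - 2 * s) + 1 / (2 * s)) * (A * ‖x₀‖ ^ (-(2 * s))) +
        (8 * A / ‖x₀‖) ^ q := by
  have hA0 : 0 < A := (hu x₀).trans hA
  set r : ℝ := ‖x₀‖ with hr
  have hr0 : 0 < r := by linarith
  set D : ℝ := 4 * A / r ^ 2 with hD
  have hD0 : 0 < D := by positivity
  -- D is chosen so that the paraboloid alone reaches A on the sphere of radius r/2, whereas the
  -- minimum is below A.
  have hDr : D * (r / 2) ^ 2 = A := by rw [hD]; field_simp; norm_num
  set w : EuclideanSpace ℝ (Fin N) → ℝ := fun y => u y + D * ‖y - x₀‖ ^ 2 with hw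
  have hnorm : ∀ y, ‖y - x₀‖ ≤ r / 2 → R₀ < ‖y‖ := by
    intro y hy
    have := norm_sub_norm_le x₀ y
    rw [norm_sub_rev] at this
    linarith
  have hcont : ContinuousOn w (Metric.closedBall x₀ (r / 2)) := by
    refine (h.continuousOn fun y hy => hnorm y (by simpa [dist_eq_norm] using hy)).add ?_
    fun_prop
  obtain ⟨x, hxmem, hxmin⟩ := (isCompact_closedBall x₀ (r / 2)).exists_isMinOn
    ⟨x₀, Metric.mem_closedBall_self (by positivity)⟩ hcont
  have hwx : w x < A := by
    have h1 : w x ≤ w x₀ := hxmin (Metric.mem_closedBall_self (by positivity))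
    have h2 : w x₀ = u x₀ := by simp [hw]
    linarith
  have hglobal : ∀ y, w x ≤ w y := by
    intro y
    rcases le_or_gt ‖y - x₀‖ (r / 2) with hy | hy
    · exact hxmin (by simpa [dist_eq_norm] using hy)
    · refine hwx.le.trans ?_
      have h1 : (r / 2) ^ 2 ≤ ‖y - x₀‖ ^ 2 := by gcongr
      have h2 := mul_le_mul_of_nonneg_left h1 hD0.le
      simp only [hw]
      linarith [hu y]
  have hxlt : ‖x - x₀‖ < r / 2 := by
    by_contra! hc
    have h1 : (r / 2) ^ 2 ≤ ‖x - x₀‖ ^ 2 := by gcongr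
    have h2 := mul_le_mul_of_nonneg_left h1 hD0.le
    simp only [hw] at hwx
    linarith [hu x]
  have hxA : u x ≤ A := by
    have : 0 ≤ D * ‖x - x₀‖ ^ 2 := by positivity
    simp only [hw] at hwx
    linarith
  have hquad : ∀ z, u x - u (x + z) ≤ inner ℝ ((2 * D) • (x - x₀)) z + D * ‖z‖ ^ 2 := by
    intro z
    have h1 := hglobal (x + z)
    simp only [hw] at h1
    have h2 : ‖x + z - x₀‖ ^ 2 = ‖x - x₀‖ ^ 2 + 2 * inner ℝ (x - x₀) z + ‖z‖ ^ 2 := by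
      rw [← norm_add_sq_real]
      congr 2
      abel
    rw [h2] at h1
    rw [real_inner_smul_left]
    linarith
  obtain ⟨L, hL, hle⟩ := h.le x (by simpa using hnorm x hxlt.le)
  have hL' := fracLaplacian_le_of_quadratic_touching hN0 hs₁ hs₂ hC h.memL2s hL hD0.le hr0
    (fun z _ => hquad z) (A := A) (fun z => by linarith [hu (x + z)])
  have hgrad : ‖gradient u x‖ ≤ 8 * A / r := by
    refine norm_gradient_le_of_eventually_sub_le (h.differentiableAt (hnorm x hxlt.le))
      (by positivity) ?_
    filter_upwards [Metric.ball_mem_nhds x hr0] with y hy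
    have hy' : ‖y - x‖ < r := by simpa [dist_eq_norm] using hy
    have h1 := hquad (y - x)
    rw [add_sub_cancel, real_inner_smul_left] at h1
    have h2 := real_inner_le_norm (x - x₀) (y - x)
    have h3 : ‖x - x₀‖ * ‖y - x‖ ≤ r / 2 * ‖y - x‖ := by gcongr
    have h4 : ‖y - x‖ ^ 2 ≤ r * ‖y - x‖ := by
      rw [sq]; gcongr
    rw [norm_sub_rev x y]
    calc u x - u y ≤ 2 * D * (r / 2 * ‖y - x‖) + D * (r * ‖y - x‖) := by
          refine h1.trans (add_le_add ?_ ?_)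
          · exact mul_le_mul_of_nonneg_left (h2.trans h3) (by positivity)
          · exact mul_le_mul_of_nonneg_left h4 hD0.le
      _ = 8 * A / r * ‖y - x‖ := by rw [hD]; field_simp; ring
  refine ⟨x, hxlt, hxA, hle.trans (add_le_add ?_ ?_)⟩
  · refine hL'.trans_eq ?_
    have e1 : D * r ^ (2 - 2 * s) = 4 * A * r ^ (-(2 * s)) := by
      rw [hD, sub_eq_add_neg, Real.rpow_add hr0, Real.rpow_two]
      field_simp
    linear_combination (C * unitSphereArea N / (2 - 2 * s)) * e1
  · exact Real.rpow_le_rpow (norm_nonneg _) hgrad hq.le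

theorem IsClassicalSupersolution.frequentlyDecays_improve {N : ℕ} (hN0 : 0 < N)
    {s C p q lam R₀ : ℝ} (hs₁ : 1 / 2 < s) (hs₂ : s < 1) (hC : 0 < C) (hlam : 0 < lam)
    (hR₀ : 0 < R₀) (hp : 0 < p) (hq : 0 < q) {f : ℝ → ℝ}
    (hf : ∀ M : ℝ, ∃ c > 0, ∀ t, 0 < t → t ≤ M → c * t ^ p ≤ f t)
    {u : EuclideanSpace ℝ (Fin N) → ℝ} (h : IsClassicalSupersolution N s C q lam R₀ f u)
    (hu : ∀ x, 0 < u x) {α α' : ℝ} (hα : 0 ≤ α) (hα' : 0 ≤ α') (h₁ : p * α' ≤ α + 2 * s)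
    (h₂ : p * α' ≤ q * (α + 1)) (hdecay : FrequentlyDecays u α) : FrequentlyDecays u α' := by
  obtain ⟨K, hK⟩ := hdecay
  -- The factor 2 makes A strictly larger than u(x₀).
  set A₀ : ℝ := 2 * K with hA₀
  obtain ⟨c, hc, hcf⟩ := hf A₀
  set C₁ : ℝ := C * unitSphereArea N * (4 / (2 - 2 * s) + 1 / (2 * s)) with hC₁
  have hC₁0 : 0 < C₁ := by
    have h1 := unitSphereArea_pos hN0
    have h2 : 0 < 2 - 2 * s := by linarith
    have h3 : 0 < s := by linarith
    positivity
  set C₂ : ℝ := (C₁ * A₀ + (8 * A₀) ^ q) / (lam * c) with hC₂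
  -- The factor 2^α' pays for moving from x₀ to x, where |x₀|/2 ≤ |x| ≤ 2|x₀|.
  refine ⟨C₂ ^ (1 / p) * 2 ^ α', fun R => ?_⟩
  obtain ⟨x₀, hx₀, hux₀⟩ := hK (max (2 * R₀ + 1) (2 * R))
  set r : ℝ := ‖x₀‖ with hr
  have hr1 : 1 ≤ r := by
    have := (le_max_left _ _).trans hx₀
    linarith
  have hr0 : 0 < r := by linarith
  have hrα : 0 < r ^ (-α) := Real.rpow_pos_of_pos hr0 _
  have hK0 : 0 < K := by
    have := (hu x₀).trans_le hux₀
    exact pos_of_mul_pos_left this hrα.le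
  have hA₀0 : 0 < A₀ := by positivity
  have hrα1 : r ^ (-α) ≤ 1 := Real.rpow_le_one_of_one_le_of_nonpos hr1 (by linarith)
  set A : ℝ := A₀ * r ^ (-α) with hA
  have hKr : 0 < K * r ^ (-α) := by positivity
  obtain ⟨x, hxx₀, hxA, hfx⟩ := h.exists_touching_point hN0 hs₁ hs₂ hC hR₀ hq hu
    (x₀ := x₀) (by have := (le_max_left _ _).trans hx₀; linarith) (A := A)
    (by rw [hA, hA₀]; linarith)
  have hxA₀ : u x ≤ A₀ := hxA.trans (by rw [hA]; nlinarith)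
  have hC₂0 : 0 < C₂ := by positivity
  have hbound : C₁ * (A * r ^ (-(2 * s))) + (8 * A / r) ^ q ≤
      (C₁ * A₀ + (8 * A₀) ^ q) * r ^ (-(p * α')) := by
    rw [add_mul]
    refine add_le_add ?_ ?_
    · rw [hA, mul_assoc A₀, ← Real.rpow_add hr0, ← mul_assoc]
      refine mul_le_mul_of_nonneg_left ?_ (by positivity)
      exact Real.rpow_le_rpow_of_exponent_le hr1 (by linarith)
    · have e1 : 8 * A / r = 8 * A₀ * r ^ (-α - 1) := by
        rw [hA, Real.rpow_sub_one hr0.ne']; ring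
      rw [e1, Real.mul_rpow (by positivity) (by positivity), ← Real.rpow_mul hr0.le]
      refine mul_le_mul_of_nonneg_left ?_ (by positivity)
      exact Real.rpow_le_rpow_of_exponent_le hr1 (by linarith)
  have hup : u x ^ p ≤ C₂ * r ^ (-(p * α')) := by
    have h3 := mul_le_mul_of_nonneg_left (hcf (u x) (hu x) hxA₀) hlam.le
    have h4 := (h3.trans hfx).trans hbound
    rw [hC₂, div_mul_eq_mul_div, le_div_iff₀ (by positivity)]
    linarith
  have hux : u x ≤ C₂ ^ (1 / p) * r ^ (-α') := by
    have h3 := Real.rpow_le_rpow (Real.rpow_nonneg (hu x).le _) hup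
      (by positivity : 0 ≤ 1 / p)
    rw [← Real.rpow_mul (hu x).le, mul_one_div_cancel hp.ne', Real.rpow_one,
      Real.mul_rpow hC₂0.le (by positivity), ← Real.rpow_mul hr0.le] at h3
    have e1 : -(p * α') * (1 / p) = -α' := by field_simp
    rwa [e1] at h3
  have h3 := norm_sub_norm_le x₀ x
  have h4 := norm_sub_norm_le x x₀
  rw [norm_sub_rev] at h3
  refine ⟨x, ?_, hux.trans ?_⟩
  · have := (le_max_right _ _).trans hx₀
    linarith
  · have hx0 : 0 < ‖x‖ := by linarith
    rw [mul_assoc]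
    refine mul_le_mul_of_nonneg_left ?_ (by positivity)
    have e1 : 2 ^ α' * ‖x‖ ^ (-α') = (‖x‖ / 2) ^ (-α') := by
      rw [Real.div_rpow hx0.le two_pos.le, Real.rpow_neg two_pos.le, div_inv_eq_mul, mul_comm]
    rw [e1]
    exact Real.rpow_le_rpow_of_nonpos (by positivity) (by linarith) (by linarith)

/-! ### Choice of exponents and conclusion. -/

theorem exists_decay_exponent {N : ℕ} {s p q : ℝ} (hs₁ : 1 / 2 < s) (hN : 2 * s < (N : ℝ))
    (hpq : (1 < q ∧ q < N / (N + 1 - 2 * s) ∧ 0 < p ∧ p < (2 * s - 1) * q / (2 * s - q)) ∨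
      (N / (N + 1 - 2 * s) ≤ q ∧ 0 < p ∧ p < N / (N - 2 * s))) :
    0 < p ∧ 1 < q ∧ ∃ θ, (N : ℝ) - 2 * s < θ ∧ θ + 2 * s ≤ q * (θ + 1) ∧ p * θ < θ + 2 * s := by
  have hden : 0 < (N : ℝ) + 1 - 2 * s := by linarith
  have hp : 0 < p := by
    rcases hpq with h | h
    · exact h.2.2.1
    · exact h.2.1
  have hq : 1 < q := by
    rcases hpq with h | h
    · exact h.1
    · exact lt_of_lt_of_le ((one_lt_div hden).2 (by linarith)) h.1
  obtain ⟨θ₀, h1, h2, h3⟩ : ∃ θ₀, (N : ℝ) - 2 * s ≤ θ₀ ∧ θ₀ + 2 * s ≤ q * (θ₀ + 1) ∧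
      p * θ₀ < θ₀ + 2 * s := by
    rcases hpq with ⟨-, hqN, -, hpN⟩ | ⟨hqN, -, hpN⟩
    · rw [lt_div_iff₀ hden] at hqN
      have hq1 : 0 < q - 1 := by linarith
      -- If q ≥ 2s, then 2s(N + 1 - 2s) < N, that is (2s - 1)(N - 2s) < 0.
      have hqs : q < 2 * s := by
        by_contra! hc
        nlinarith
      rw [lt_div_iff₀ (by linarith)] at hpN
      -- This is the root of θ + 2s = q(θ + 1), where gradient and diffusion scale alike. For larger
      -- q the choice N - 2s works.
      refine ⟨(2 * s - q) / (q - 1), ?_, ?_, ?_⟩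
      · rw [le_div_iff₀ hq1]
        linarith
      · refine le_of_eq ?_
        field_simp
        ring
      · have e1 : (2 * s - q) / (q - 1) + 2 * s = q * (2 * s - 1) / (q - 1) := by
          field_simp
          ring
        rw [e1, ← mul_div_assoc]
        exact div_lt_div_of_pos_right (by linarith) hq1
    · rw [div_le_iff₀ hden] at hqN
      rw [lt_div_iff₀ (by linarith)] at hpN
      exact ⟨(N : ℝ) - 2 * s, le_rfl, by linarith, by linarith⟩
  -- A small shift makes θ > N - 2s strict; dividing the slack by p + 1 preserves pθ < θ + 2s, and q
  -- > 1 preserves the remaining inequality.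
  refine ⟨hp, hq, θ₀ + (θ₀ + 2 * s - p * θ₀) / (p + 1), ?_, ?_, ?_⟩
  all_goals
    have hη : 0 < (θ₀ + 2 * s - p * θ₀) / (p + 1) := div_pos (by linarith) (by linarith)
    have hη' : (θ₀ + 2 * s - p * θ₀) / (p + 1) * (p + 1) = θ₀ + 2 * s - p * θ₀ :=
      div_mul_cancel₀ _ (by linarith)
    generalize (θ₀ + 2 * s - p * θ₀) / (p + 1) = η at *
  · linarith
  · nlinarith
  · nlinarith

/-- Both slacks are affine in α, so they are bounded below on [0, θ] by their endpoint values, which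
are positive. -/
theorem exists_exponent_increment {s p q θ : ℝ} (hs : 0 < s) (hp : 0 < p) (hq : 1 < q)
    (hθ : 0 < θ) (hθq : θ + 2 * s ≤ q * (θ + 1)) (hθp : p * θ < θ + 2 * s) :
    ∃ δ > 0, ∀ α, 0 ≤ α → α ≤ θ → p * (α + δ) ≤ α + 2 * s ∧ p * (α + δ) ≤ q * (α + 1) := by
  refine ⟨min (min (2 * s) q) (θ + 2 * s - p * θ) / p, ?_, fun α h0 h1 => ?_⟩
  · refine div_pos (lt_min (lt_min (by linarith) (by linarith)) (by linarith)) hp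
  · rw [mul_add, mul_div_cancel₀ _ hp.ne']
    set η := min (min (2 * s) q) (θ + 2 * s - p * θ)
    have e1 : η ≤ 2 * s := (min_le_left _ _).trans (min_le_left _ _)
    have e2 : η ≤ q := (min_le_left _ _).trans (min_le_right _ _)
    have e3 : η ≤ θ + 2 * s - p * θ := min_le_right _ _
    have key : ∀ b d : ℝ, η ≤ d → η ≤ b * θ + d → η ≤ b * α + d := by
      intro b d hd hbd
      rcases le_total 0 b with hb | hb <;> nlinarith
    have k1 := key (1 - p) (2 * s) e1 (by linarith)
    have k2 := key (q - p) q e2 (by linarith)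
    constructor <;> linarith

theorem theorem1 (N : ℕ) (s C : ℝ) (hs₁ : 1 / 2 < s) (hs₂ : s < 1) (hN : 2 * s < (N : ℝ))
    (hC : 0 < C) (p q lam R₀ : ℝ) (hlam : 0 < lam) (hR₀ : 0 < R₀)
    (f : ℝ → ℝ) (hf_cont : ContinuousOn f (Set.Ioi 0)) (hf_pos : ∀ t : ℝ, 0 < t → 0 < f t)
    (hf_liminf : 0 < liminf (fun t : ℝ => ((f t / t ^ p : ℝ) : EReal)) (𝓝[>] (0 : ℝ)))
    (hpq : (1 < q ∧ q < N / (N + 1 - 2 * s) ∧ 0 < p ∧ p < (2 * s - 1) * q / (2 * s - q)) ∨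
      (N / (N + 1 - 2 * s) ≤ q ∧ 0 < p ∧ p < N / (N - 2 * s))) :
    ¬ ∃ u : EuclideanSpace ℝ (Fin N) → ℝ,
        IsClassicalSupersolution N s C q lam R₀ f u ∧ (∀ x, 0 < u x) ∧
          ¬ BlowsUpAtInfinity u := by
  rintro ⟨u, h, hu, hblow⟩
  have hN0 : 0 < N := by
    have : (0 : ℝ) < N := by linarith
    exact_mod_cast this
  obtain ⟨hp, hq, θ, hθ, hθq, hθp⟩ := exists_decay_exponent hs₁ hN hpq
  have hθ0 : 0 < θ := by linarith
  obtain ⟨κ, hκ, R₂, hlower⟩ :=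
    h.lower_bound hN0 hs₁ hs₂ hN hC hlam hR₀ hq hθ hθq hf_pos hu
  obtain ⟨δ, hδ, hstep⟩ := exists_exponent_increment (by linarith) hp hq hθ0 hθq hθp
  have hf := exists_rpow_le_of_liminf_pos hf_cont hf_pos hf_liminf
  have hdecay : ∀ k : ℕ, FrequentlyDecays u (k * δ) := by
    intro k
    induction k with
    | zero => simpa using frequentlyDecays_zero_of_not_blowsUp hblow
    | succ k ih =>
      have hkθ : k * δ ≤ θ := by
        by_contra! hc
        exact not_frequentlyDecays_of_lower_bound hκ hlower hc ih
      obtain ⟨h₁, h₂⟩ := hstep (k * δ) (by positivity) hkθ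
      have e1 : ((k + 1 : ℕ) : ℝ) * δ = k * δ + δ := by push_cast; ring
      rw [e1]
      exact h.frequentlyDecays_improve hN0 hs₁ hs₂ hC hlam hR₀ hp (by linarith) hf hu
        (by positivity) (by positivity) h₁ h₂ ih
  obtain ⟨k, hk⟩ := exists_nat_gt (θ / δ)
  rw [div_lt_iff₀ hδ] at hk
  exact not_frequentlyDecays_of_lower_bound hκ hlower hk (hdecay k)
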